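/- Let $d\ge 2$ and let $K\subset\mathbb{R}^d$ be a convex body (compact, convex, with non-empty interior) of class $\mathcal{C}^{1,1}$, that is, $\partial K$ is a $C^1$ hypersurface and the Gauss map $\mathbf{n}_K:\partial K\to\mathbb{S}^{d-1}$ (the unique outer unit normal) is Lipschitz. Let $\phi:K\to(0,\infty)$ be continuous. For $\mathbf{u}\in\mathbb{S}^{d-1}$ and $t\in\mathbb{R}$ put $H^+(\mathbf{u},t)=\{\mathbf{x}:\mathbf{u}\cdot\mathbf{x}\ge t\}$ and $H^-(\mathbf{u},t)=\{\mathbf{x}:\mathbf{u}\cdot\mathbf{x}\le t\}$, and for $\delta>0$ define the $\phi$-weighted floating body $$K_\delta^\phi=\bigcap\Big\{H^-(\mathbf{u},t):\ \mathbf{u}\in\mathbb{S}^{d-1},\ t\in\mathbb{R},\ \int_{K\cap H^+(\mathbf{u},t)}\phi(\mathbf{x})\,d\mathbf{x}\le\delta\Big\}.$$ For a compact set $L\neq\emptyset$ let $h_L(\mathbf{y})=\max_{\mathbf{x}\in L}\mathbf{y}\cdot\mathbf{x}$ be its support function, and let $$a_d=\frac{(2\pi)^{\frac{d-1}{2}}}{\Gamma\left(\frac{d+1}{2}+1\right)}.$$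 A point $\mathbf{x}\in\partial K$ is called normal if it has a unique outer unit normal $\mathbf{n}$ and if the function $f(\mathbf{y})=\min\{t:\mathbf{x}+\mathbf{y}-t\mathbf{n}\in K\}$, defined for $\mathbf{y}\in\mathbf{n}^\perp$ near $0$, whose graph represents $\partial K$ near $\mathbf{x}$, satisfies $f(\mathbf{y})=\tfrac12\langle A\mathbf{y},\mathbf{y}\rangle+o(\|\mathbf{y}\|^2)$ as $\mathbf{y}\to0$ for some self-adjoint linear map $A:\mathbf{n}^\perp\to\mathbf{n}^\perp$; its generalized Gauss--Kronecker curvature is then $H_{d-1}(K,\mathbf{x})=\det A$. Then $K_\delta^\phi\ne\emptyset$ for all sufficiently small $\delta>0$, and for almost every $\mathbf{u}\in\mathbb{S}^{d-1}$ with respect to the $(d-1)$-dimensional Hausdorff measure, $h_K$ is differentiable at $\mathbf{u}$, the point $\nabla h_K(\mathbf{u})$ is a normal boundary point of $K$, and $$\lim_{\delta\to0^+}\frac{h_K(\mathbf{u})-h_{K_\delta^\phi}(\mathbf{u})}{\delta^{\frac{2}{d+1}}}=\left(\frac{H_{d-1}(K,\nabla h_K(\mathbf{u}))}{a_d^2\,\phi(\nabla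 h_K(\mathbf{u}))^2}\right)^{\frac{1}{d+1}}.$$ -/

import Mathlib

open Set Filter Topology MeasureTheory
open scoped NNReal ENNReal

noncomputable section

namespace ConvexFloating

section Geometry

variable {E : Type*} [NormedAddCommGroup E] [InnerProductSpace ℝ E]

/-- The closed half-space `H⁺(u, t) = {x | t ≤ ⟨u, x⟩}`. -/
def halfSpaceGE (u : E) (t : ℝ) : Set E := {x | t ≤ inner ℝ u x}

/-- The closed half-space `H⁻(u, t) = {x | ⟨u, x⟩ ≤ t}`. -/
def halfSpaceLE (u : E) (t : ℝ) : Set E := {x | inner ℝ u x ≤ t}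

/-- The support function `h(K, y) = sup {⟨y, x⟩ | x ∈ K}`. -/
def supportFn (K : Set E) (y : E) : ℝ := sSup ((fun x => inner ℝ y x) '' K)

/-- `u` is an outer unit normal vector of `K` at `x`. -/
def IsOuterUnitNormal (K : Set E) (x u : E) : Prop :=
  ‖u‖ = 1 ∧ ∀ y ∈ K, inner ℝ u y ≤ inner ℝ u x

/-- `S` is an embedded `C¹` hypersurface: locally it is the zero set of a `C¹` function
whose derivative does not vanish. -/
def IsC1Hypersurface (S : Set E) : Prop :=
  ∀ x ∈ S, ∃ U : Set E, IsOpen U ∧ x ∈ U ∧ ∃ g : E → ℝ,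
    ContDiffOn ℝ 1 g U ∧ (∀ y ∈ U, fderiv ℝ g y ≠ 0) ∧ S ∩ U = {y ∈ U | g y = 0}

/-- `n` is the Gauss map of `K`: at every boundary point `x`, `n x` is the one and only
outer unit normal vector of `K`. -/
def IsGaussMap (K : Set E) (n : E → E) : Prop :=
  ∀ x ∈ frontier K, ∀ u : E, IsOuterUnitNormal K x u ↔ u = n x

/-- `K` is of class `C^{1,1}`: its boundary is a `C¹` hypersurface and its Gauss map is
Lipschitz on the boundary. -/
def IsClassC11 (K : Set E) : Prop :=
  IsC1Hypersurface (frontier K) ∧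
    ∃ n : E → E, IsGaussMap K n ∧ ∃ L : ℝ≥0, LipschitzOnWith L n (frontier K)

/-- The function, defined on the linear hyperplane orthogonal to `n`, whose graph over the
tangent hyperplane of `K` at `x` (with heights measured in the direction `-n`) is the boundary
of `K` near `x`. -/
def localRep (K : Set E) (x n : E) (y : (ℝ ∙ n)ᗮ) : ℝ :=
  sInf {t : ℝ | x + (y : E) - t • n ∈ K}

/-- The self-adjoint operator `A` represents the Hessian at the origin of the local
representation `f` of the boundary of `K` at `x`, that is,
`f y = ⟨A y, y⟩ / 2 + o(‖y‖²)` as `y → 0`. -/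
def HasLocalHessian (K : Set E) (x n : E) (A : (ℝ ∙ n)ᗮ →ₗ[ℝ] (ℝ ∙ n)ᗮ) : Prop :=
  A.IsSymmetric ∧
    (fun y : (ℝ ∙ n)ᗮ => localRep K x n y - (1 / 2) * inner ℝ (A y) y)
      =o[𝓝 0] (fun y : (ℝ ∙ n)ᗮ => ‖y‖ ^ 2)

/-- `x` is a normal boundary point of `K`: it has a unique outer unit normal vector, and the
local representation of the boundary at `x` is twice differentiable at the origin. -/
def IsNormalBoundaryPoint (K : Set E) (x : E) : Prop :=
  x ∈ frontier K ∧ ∃ n : E, (∀ u : E, IsOuterUnitNormal K x u ↔ u = n) ∧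
    ∃ A : (ℝ ∙ n)ᗮ →ₗ[ℝ] (ℝ ∙ n)ᗮ, HasLocalHessian K x n A

/-- `x` is a normal boundary point of `K` at which the product of the generalized principal
curvatures, i.e. the determinant of the Hessian of the local representation, is `κ`. -/
def HasGaussKronecker (K : Set E) (x : E) (κ : ℝ) : Prop :=
  x ∈ frontier K ∧ ∃ n : E, (∀ u : E, IsOuterUnitNormal K x u ↔ u = n) ∧
    ∃ A : (ℝ ∙ n)ᗮ →ₗ[ℝ] (ℝ ∙ n)ᗮ, HasLocalHessian K x n A ∧ LinearMap.det A = κ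

open Classical in
/-- The generalized Gauss–Kronecker curvature `H_{d-1}(K, x)` at a normal boundary point `x`
(and `0` at all other points). -/
def gaussKronecker (K : Set E) (x : E) : ℝ :=
  if h : ∃ κ, HasGaussKronecker K x κ then h.choose else 0

theorem hasLocalHessian_unique {K : Set E} {x n : E} {A B : (ℝ ∙ n)ᗮ →ₗ[ℝ] (ℝ ∙ n)ᗮ}
    (hA : HasLocalHessian K x n A) (hB : HasLocalHessian K x n B) : A = B := by
  have hsub : (A - B).IsSymmetric := hA.1.sub hB.1
  have ho := hB.2.sub hA.2
  have key : ∀ y : (ℝ ∙ n)ᗮ, inner ℝ ((A - B) y) y = 0 := by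
    intro y
    by_contra hne
    have hy : y ≠ 0 := by
      rintro rfl
      simp at hne
    have hny : 0 < ‖y‖ ^ 2 := by positivity
    have hc : 0 < |inner ℝ ((A - B) y) y| / (4 * ‖y‖ ^ 2) := by positivity
    have hev := ho.def hc
    have ht : Tendsto (fun t : ℝ => t • y) (𝓝[>] 0) (𝓝 0) := by
      have : Tendsto (fun t : ℝ => t • y) (𝓝 0) (𝓝 ((0 : ℝ) • y)) :=
        (continuous_id.smul continuous_const).tendsto 0
      rw [zero_smul] at this
      exact this.mono_left nhdsWithin_le_nhds
    obtain ⟨t, h1, ht0⟩ := ((ht.eventually hev).and self_mem_nhdsWithin).exists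
    have ht0' : (0 : ℝ) < t := ht0
    have e1 : localRep K x n (t • y) - 1 / 2 * inner ℝ (B (t • y)) (t • y)
        - (localRep K x n (t • y) - 1 / 2 * inner ℝ (A (t • y)) (t • y))
        = t ^ 2 * (1 / 2 * inner ℝ ((A - B) y) y) := by
      simp only [map_smul, inner_smul_left, inner_smul_right, LinearMap.sub_apply,
        inner_sub_left, conj_trivial]
      ring
    rw [e1] at h1
    simp only [Real.norm_eq_abs, abs_mul, norm_smul, mul_pow, abs_pow] at h1
    simp only [abs_of_pos ht0', abs_of_pos (by norm_num : (0 : ℝ) < 1 / 2), abs_norm] at h1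
    have e2 : |inner ℝ ((A - B) y) y| / (4 * ‖y‖ ^ 2) * (t ^ 2 * ‖y‖ ^ 2)
        = t ^ 2 * (1 / 4 * |inner ℝ ((A - B) y) y|) := by
      field_simp
    rw [e2] at h1
    have := le_of_mul_le_mul_left h1 (by positivity)
    have : 0 < |inner ℝ ((A - B) y) y| := abs_pos.mpr hne
    linarith
  exact sub_eq_zero.mp (hsub.inner_map_self_eq_zero.mp key)

/-- The generalized Gauss–Kronecker curvature is well defined. -/
theorem HasGaussKronecker.gaussKronecker_eq {K : Set E} {x : E} {κ : ℝ}
    (h : HasGaussKronecker K x κ) : gaussKronecker K x = κ := by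
  have hex : ∃ κ, HasGaussKronecker K x κ := ⟨κ, h⟩
  rw [gaussKronecker, dif_pos hex]
  obtain ⟨-, n, hn, A, hA, hκ⟩ := h
  obtain ⟨-, m, hm, B, hB, hκ'⟩ := hex.choose_spec
  obtain rfl : n = m := (hm n).mp ((hn n).mpr rfl)
  rw [← hκ', ← hκ, hasLocalHessian_unique hA hB]

end Geometry

section Weighted

variable {E : Type*} [NormedAddCommGroup E] [InnerProductSpace ℝ E] [MeasureSpace E]

/-- The `φ`-weighted volume of `S`: the integral of the density `φ` over `S`. -/
def weightedVolume (φ : E → ℝ) (S : Set E) : ℝ≥0∞ := ∫⁻ x in S, ENNReal.ofReal (φ x)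

/-- The weighted floating body: the intersection of all closed half-spaces `H⁻` whose
complementary closed half-space `H⁺` cuts off from `K` a part of `φ`-volume at most `δ`. -/
def floatingBody (K : Set E) (φ : E → ℝ) (δ : ℝ) : Set E :=
  ⋂₀ {H | ∃ u : E, ∃ t : ℝ, ‖u‖ = 1 ∧
    weightedVolume φ (K ∩ halfSpaceGE u t) ≤ ENNReal.ofReal δ ∧ H = halfSpaceLE u t}

end Weighted

/-- The constant `a_d = (2π)^((d-1)/2) / Γ((d+1)/2 + 1)`, which is the volume of the parabolic
cap `{(y, z) ∈ ℝ^{d-1} × ℝ | ‖y‖² / 2 ≤ z ≤ 1}`. -/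
def capConst (d : ℕ) : ℝ :=
  (2 * Real.pi) ^ (((d : ℝ) - 1) / 2) / Real.Gamma (((d : ℝ) + 1) / 2 + 1)

end ConvexFloating

end

/-! Write `d = m + 1`. Let `x` be a boundary point with unique normal `u` and positive definite
local Hessian `A`. Near `x` the body is, to leading order, the solid paraboloid `t ≥ ⟨A y, y⟩ / 2`,
whose cap of height `s` has volume `a_d s^p / √(det A)` with `p = (d + 1) / 2`. Since `φ` is
continuous, the hyperplane orthogonal to `u` at depth `s` cuts off weighted volume `V s^p` to
leading order, with `V = φ x · a_d / √(det A)` (`weightedVolume_cap_le`), and this half-space bounds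
the floating body in direction `u`. Conversely `x - s u` lies in the floating body once every
half-space through it cuts off more than `δ`. So a lower bound `V s^p`, to leading order, is needed
uniformly in the direction (`le_weightedVolume_cap`). For the paraboloid it comes from
volume-preserving shears that map the paraboloid to itself and make tilted hyperplanes horizontal
(`volume_paraboloidCap_one_le`). Inverting `δ = V s^p` gives the limit `V^(-1/p)`, which is the
stated expression (`tendsto_supportFn_sub_div`).

It remains to see that almost every `u` is the normal at such a point. The Gauss map extends,
positively homogeneously about an interior point, to a Lipschitz map `Φ` of the whole space
(`exists_lipschitzWith_radialExtension`). By Rademacher's theorem and the vanishing-Jacobian case of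
Sard's theorem, the values taken at points where `Φ` is not differentiable or has singular
derivative form a null cone, which meets the sphere in a null set
(`ae_sphere_hasFDerivAt_preimage`). For every other `u`, the tangential part of the derivative is
the local Hessian (`IsGraphOver.hasLocalHessian`) and is injective (`tangential_injective`). It is
nonnegative because `K` lies below its tangent hyperplane, hence positive definite. So zero
curvature occurs only for a null set of directions. Positive definiteness also makes the support
point unique, whence `h_K` is differentiable at `u` with gradient `x`. -/

noncomputable section

namespace ConvexFloating

/-! ### Volumes of paraboloid caps cut off by arbitrary half-spaces -/

section ParaboloidVolume

variable {m : ℕ}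

/-- The truncated solid paraboloid `{(y, t) | ‖y‖² / 2 ≤ t ≤ τ}`. -/
def paraboloidCap (m : ℕ) (τ : ℝ) : Set (EuclideanSpace ℝ (Fin m) × ℝ) :=
  {p | 1 / 2 * ‖p.1‖ ^ 2 ≤ p.2 ∧ p.2 ≤ τ}

theorem measurableSet_paraboloidCap (τ : ℝ) : MeasurableSet (paraboloidCap m τ) := by
  have h1 : IsClosed {p : EuclideanSpace ℝ (Fin m) × ℝ | 1 / 2 * ‖p.1‖ ^ 2 ≤ p.2} :=
    isClosed_le (by fun_prop) (by fun_prop)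
  have h2 : IsClosed {p : EuclideanSpace ℝ (Fin m) × ℝ | p.2 ≤ τ} :=
    isClosed_le (by fun_prop) (by fun_prop)
  exact (h1.inter h2).measurableSet

theorem capConst_pos (d : ℕ) : 0 < capConst d := by
  unfold capConst
  have : 0 < Real.Gamma (((d : ℝ) + 1) / 2 + 1) := Real.Gamma_pos_of_pos (by positivity)
  positivity

/-- The slice at height `t` is a ball of radius `√(2t)`; integrating over `t` raises the exponent `m
/ 2` by one, and the resulting factor is absorbed by the recursion of the Gamma function. -/
theorem volume_paraboloidCap [NeZero m] {τ : ℝ} (hτ : 0 ≤ τ) :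
    volume (paraboloidCap m τ) =
      ENNReal.ofReal (capConst (m + 1) * τ ^ (((m : ℝ) + 2) / 2)) := by
  have hm : (0 : ℝ) ≤ (m : ℝ) / 2 := by positivity
  set C : ℝ := √Real.pi ^ m / Real.Gamma ((m : ℝ) / 2 + 1) with hC
  have hGpos : 0 < Real.Gamma ((m : ℝ) / 2 + 1) := Real.Gamma_pos_of_pos (by positivity)
  have hC0 : 0 ≤ C := by positivity
  have hslice : ∀ t : ℝ, volume ((fun y : EuclideanSpace ℝ (Fin m) => (y, t)) ⁻¹'
      paraboloidCap m τ) =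
        (Icc 0 τ).indicator
          (fun t => ENNReal.ofReal (C * 2 ^ ((m : ℝ) / 2) * t ^ ((m : ℝ) / 2))) t := by
    intro t
    by_cases ht : t ∈ Icc 0 τ
    · rw [indicator_of_mem ht]
      have : (fun y : EuclideanSpace ℝ (Fin m) => (y, t)) ⁻¹' paraboloidCap m τ =
          Metric.closedBall 0 (√(2 * t)) := by
        ext y
        simp only [paraboloidCap, mem_preimage, mem_ofPred_eq, Metric.mem_closedBall, dist_zero_right]
        rw [Real.le_sqrt (norm_nonneg _) (by linarith [ht.1])]
        constructor
        · intro h; linarith [h.1]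
        · intro h; exact ⟨by linarith, ht.2⟩
      rw [this, EuclideanSpace.volume_closedBall, Fintype.card_fin,
        ← ENNReal.ofReal_pow (Real.sqrt_nonneg _), ← ENNReal.ofReal_mul (by positivity)]
      congr 1
      have h2 : √(2 * t) ^ m = 2 ^ ((m : ℝ) / 2) * t ^ ((m : ℝ) / 2) := by
        rw [← Real.mul_rpow (by norm_num) ht.1, Real.sqrt_eq_rpow, ← Real.rpow_natCast,
          ← Real.rpow_mul (by linarith [ht.1])]
        congr 1; ring
      rw [h2, hC]; ring
    · rw [indicator_of_notMem ht]
      have : (fun y : EuclideanSpace ℝ (Fin m) => (y, t)) ⁻¹' paraboloidCap m τ = ∅ := by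
        ext y
        simp only [paraboloidCap, mem_preimage, mem_ofPred_eq, mem_empty_iff_false, iff_false]
        intro h
        exact ht ⟨le_trans (by positivity) h.1, h.2⟩
      rw [this, measure_empty]
  rw [Measure.volume_eq_prod, Measure.prod_apply_symm (measurableSet_paraboloidCap τ)]
  simp_rw [hslice]
  rw [lintegral_indicator measurableSet_Icc, ← ofReal_integral_eq_lintegral_ofReal]
  · congr 1
    rw [integral_Icc_eq_integral_Ioc, ← intervalIntegral.integral_of_le hτ,
      intervalIntegral.integral_const_mul, integral_rpow (Or.inl (by linarith)),
      Real.zero_rpow (by linarith), sub_zero]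
    have e1 : (m : ℝ) / 2 + 1 = ((m : ℝ) + 2) / 2 := by ring
    have e2 : capConst (m + 1) =
        (2 * Real.pi) ^ ((m : ℝ) / 2) / Real.Gamma (((m : ℝ) / 2 + 1) + 1) := by
      unfold capConst
      push_cast
      congr 3 <;> ring
    rw [e2, Real.Gamma_add_one (by positivity), hC, ← e1, Real.mul_rpow (by norm_num) Real.pi_pos.le]
    have e3 : √Real.pi ^ m = Real.pi ^ ((m : ℝ) / 2) := by
      rw [Real.sqrt_eq_rpow, ← Real.rpow_natCast, ← Real.rpow_mul Real.pi_pos.le]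
      congr 1; ring
    rw [e3]
    field_simp
  · apply ContinuousOn.integrableOn_Icc
    exact (continuous_const.mul (Real.continuous_rpow_const hm)).continuousOn
  · refine (ae_restrict_iff' measurableSet_Icc).2 (Eventually.of_forall fun t ht => ?_)
    have := ht.1
    simp only [Pi.zero_apply]
    positivity

theorem volume_paraboloidCap_le_mul [NeZero m] {τ : ℝ} (hτ : 1 ≤ τ) :
    ENNReal.ofReal τ * volume (paraboloidCap m 1) ≤ volume (paraboloidCap m τ) := by
  rw [volume_paraboloidCap zero_le_one, volume_paraboloidCap (by linarith), Real.one_rpow, mul_one,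
    ← ENNReal.ofReal_mul (by linarith), mul_comm]
  apply ENNReal.ofReal_le_ofReal
  have := capConst_pos (m + 1)
  gcongr
  calc τ = τ ^ (1 : ℝ) := (Real.rpow_one τ).symm
    _ ≤ _ := Real.rpow_le_rpow_of_exponent_le hτ (by
      have : (0 : ℝ) ≤ m := by positivity
      linarith)

theorem volume_paraboloidCap_le_two_mul_half (τ : ℝ) (b : EuclideanSpace ℝ (Fin m)) :
    volume (paraboloidCap m τ) ≤ 2 * volume (paraboloidCap m τ ∩ {p | 0 ≤ inner ℝ b p.1}) := by
  set H := paraboloidCap m τ ∩ {p | 0 ≤ inner ℝ b p.1}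
  have hmp : MeasurePreserving (fun p : EuclideanSpace ℝ (Fin m) × ℝ => (-p.1, p.2)) :=
    (Measure.measurePreserving_neg volume).prod (MeasurePreserving.id volume)
  have hHm : MeasurableSet H := (measurableSet_paraboloidCap τ).inter
    (isClosed_le (by fun_prop) (by fun_prop)).measurableSet
  have hsub : paraboloidCap m τ ⊆
      H ∪ (fun p : EuclideanSpace ℝ (Fin m) × ℝ => (-p.1, p.2)) ⁻¹' H := by
    intro p hp
    rcases le_total 0 (inner ℝ b p.1) with h | h
    · exact Or.inl ⟨hp, h⟩
    · refine Or.inr ⟨?_, ?_⟩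
      · simpa [paraboloidCap] using hp
      · simpa using h
  calc volume (paraboloidCap m τ) ≤ _ := measure_mono hsub
    _ ≤ _ := measure_union_le _ _
    _ = 2 * volume H := by rw [hmp.measure_preimage hHm.nullMeasurableSet, two_mul]

/-- These shears map the infinite paraboloid `‖y‖² / 2 ≤ t` to itself, because the height gains
exactly the increase of `‖y‖² / 2` under translation by `c`. They act transitively on its boundary,
so they reduce oblique caps to horizontal ones. -/
theorem measurePreserving_shear (c : EuclideanSpace ℝ (Fin m)) :
    MeasurePreserving (fun p : EuclideanSpace ℝ (Fin m) × ℝ =>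
      (p.1 + c, p.2 + (inner ℝ c p.1 + 1 / 2 * ‖c‖ ^ 2))) := by
  refine MeasurePreserving.skew_product
    (g := fun (w : EuclideanSpace ℝ (Fin m)) (t : ℝ) => t + (inner ℝ c w + 1 / 2 * ‖c‖ ^ 2))
    (measurePreserving_add_right volume c) ?_ ?_
  · exact Continuous.measurable (by fun_prop)
  · exact Eventually.of_forall fun w => (measurePreserving_add_right volume _).map_eq

/-- A half-space through `(0, 1)` cuts off from the paraboloid, truncated at height `10`, at least
the volume of the horizontal cap of height `1`. -/
theorem volume_paraboloidCap_one_le [NeZero m] (b : EuclideanSpace ℝ (Fin m)) (β : ℝ) :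
    volume (paraboloidCap m 1) ≤
      volume (paraboloidCap m 10 ∩ {p | 0 ≤ inner ℝ b p.1 + β * (1 - p.2)}) := by
  have hfin : volume (paraboloidCap m 1) ≠ ∞ := by
    rw [volume_paraboloidCap zero_le_one]; exact ENNReal.ofReal_ne_top
  have hTm : MeasurableSet (paraboloidCap m 10 ∩ {p | 0 ≤ inner ℝ b p.1 + β * (1 - p.2)}) :=
    (measurableSet_paraboloidCap _).inter (isClosed_le (by fun_prop) (by fun_prop)).measurableSet
  rcases le_or_gt β 0 with hβ | hβ
  -- The half-space contains the half `⟨b, y⟩ ≥ 0` of the slab above height `1`. With `V` the volume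
  -- of the unit cap, this half-slab has volume at least `10 V / 2 - V ≥ V`.
  · have hsub : (paraboloidCap m 10 ∩ {p | 0 ≤ inner ℝ b p.1}) \ paraboloidCap m 1 ⊆
        paraboloidCap m 10 ∩ {p | 0 ≤ inner ℝ b p.1 + β * (1 - p.2)} := by
      rintro p ⟨⟨hp, hb⟩, h1⟩
      refine ⟨hp, ?_⟩
      have h2 : 1 < p.2 := by
        by_contra hlt
        exact h1 ⟨hp.1, not_lt.1 hlt⟩
      simp only [mem_ofPred_eq] at hb ⊢
      nlinarith
    refine le_trans ?_ (measure_mono hsub)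
    refine le_trans ?_ (le_measure_sdiff)
    have h10 := (volume_paraboloidCap_le_mul (m := m) (τ := 10) (by norm_num)).trans
      (volume_paraboloidCap_le_two_mul_half 10 b)
    have hfin' : volume (paraboloidCap m 10 ∩ {p | 0 ≤ inner ℝ b p.1}) ≠ ∞ := by
      refine ne_top_of_le_ne_top ?_ (measure_mono inter_subset_left)
      rw [volume_paraboloidCap (by norm_num)]; exact ENNReal.ofReal_ne_top
    lift volume (paraboloidCap m 1) to ℝ≥0 using hfin with V
    lift volume (paraboloidCap m 10 ∩ {p | 0 ≤ inner ℝ b p.1}) to ℝ≥0 using hfin' with W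
    rw [ENNReal.ofReal_ofNat] at h10
    have h10' : (10 : ℝ) * V ≤ 2 * W := by
      have : ((10 * V : ℝ≥0) : ℝ≥0∞) ≤ ((2 * W : ℝ≥0) : ℝ≥0∞) := by push_cast; exact h10
      exact_mod_cast ENNReal.coe_le_coe.1 this
    norm_cast
    rw [← NNReal.coe_le_coe]
    have hV : (0 : ℝ) ≤ V := V.2
    have : V ≤ W := by
      rw [← NNReal.coe_le_coe]
      linarith
    rw [NNReal.coe_sub this]
    linarith
  -- After division by `β` the half-space is `t ≤ 1 + ⟨b, y⟩`. The shear by `b` pulls it back to `τ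
  -- ≤ 1 + ‖b‖² / 2`, which contains the unit cap; for `‖b‖ ≤ 2` the sheared unit cap stays below
  -- height `6`.
  · obtain ⟨b, rfl⟩ : ∃ b', b = β • b' := ⟨β⁻¹ • b, by rw [smul_inv_smul₀ hβ.ne']⟩
    rcases le_or_gt ‖b‖ 2 with hb | hb
    · rw [← (measurePreserving_shear b).measure_preimage hTm.nullMeasurableSet]
      apply measure_mono
      rintro ⟨w, τ⟩ ⟨h1, h2⟩
      simp only at h1 h2
      have hcs : inner ℝ b w ≤ 1 / 2 * ‖b‖ ^ 2 + 1 / 2 * ‖w‖ ^ 2 := by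
        nlinarith [real_inner_le_norm b w, sq_nonneg (‖b‖ - ‖w‖)]
      have hb2 : ‖b‖ ^ 2 ≤ 4 := by nlinarith [norm_nonneg b]
      refine ⟨⟨?_, ?_⟩, ?_⟩
      · simp only [norm_add_sq_real, real_inner_comm b w]
        linarith
      · simp only; linarith
      · simp only [mem_ofPred_eq, inner_smul_left, inner_add_right, real_inner_self_eq_norm_sq,
          conj_trivial]
        rw [← mul_add]
        apply mul_nonneg hβ.le
        nlinarith [sq_nonneg ‖b‖]
    -- A steep `b` would push the sheared cap beyond the truncation, so shear by the vector `c` of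
    -- length `2` in its direction. On the half `⟨c, w⟩ ≥ 0` the condition becomes implied by `τ ≤ 4
    -- l - 1`, and `4 l - 1 ≥ 3`. Half of the cap of height `3` has at least the volume of the unit
    -- cap, and its image reaches height at most `3 + 5 + 2 = 10`, which explains the truncation.
    · set c := (2 / ‖b‖) • b with hc
      have hb0 : 0 < ‖b‖ := by linarith
      set l := ‖b‖ / 2 with hl
      have hl1 : 1 ≤ l := by rw [hl]; linarith
      have hbc : b = l • c := by
        rw [hc, smul_smul, hl, show ‖b‖ / 2 * (2 / ‖b‖) = 1 by field_simp, one_smul]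
      have hcn : ‖c‖ = 2 := by
        rw [hc, norm_smul, Real.norm_of_nonneg (by positivity)]; field_simp
      have hhalf : volume (paraboloidCap m 1) ≤
          volume (paraboloidCap m 3 ∩ {p | 0 ≤ inner ℝ c p.1}) := by
        have h3 := (volume_paraboloidCap_le_mul (m := m) (τ := 3) (by norm_num)).trans
          (volume_paraboloidCap_le_two_mul_half 3 c)
        rw [ENNReal.ofReal_ofNat] at h3
        have h2 : 2 * volume (paraboloidCap m 1) ≤ 3 * volume (paraboloidCap m 1) := by
          gcongr; norm_num
        exact (ENNReal.mul_le_mul_iff_right (by norm_num) (by norm_num)).1 (h2.trans h3)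
      refine hhalf.trans ?_
      rw [← (measurePreserving_shear c).measure_preimage hTm.nullMeasurableSet]
      apply measure_mono
      rintro ⟨w, τ⟩ ⟨⟨h1, h2⟩, h3⟩
      simp only [mem_ofPred_eq] at h1 h2 h3
      have hcs : inner ℝ c w ≤ 1 / 2 * ‖c‖ ^ 2 + 1 / 2 * ‖w‖ ^ 2 := by
        nlinarith [real_inner_le_norm c w, sq_nonneg (‖c‖ - ‖w‖)]
      rw [hcn] at hcs
      refine ⟨⟨?_, ?_⟩, ?_⟩
      · simp only [norm_add_sq_real, real_inner_comm c w]
        linarith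
      · simp only [hcn]; linarith
      · rw [hbc]
        simp only [mem_ofPred_eq, inner_smul_left, inner_add_right, real_inner_self_eq_norm_sq,
          conj_trivial, hcn]
        rw [← mul_add]
        apply mul_nonneg hβ.le
        nlinarith

variable (S : EuclideanSpace ℝ (Fin m) →ₗ[ℝ] EuclideanSpace ℝ (Fin m))

/-- The truncated solid paraboloid `{(y, t) | ‖S y‖² / 2 ≤ t ≤ τ}`. -/
def ellipticCap (τ : ℝ) : Set (EuclideanSpace ℝ (Fin m) × ℝ) :=
  {p | 1 / 2 * ‖S p.1‖ ^ 2 ≤ p.2 ∧ p.2 ≤ τ}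

/-- The parabolic rescaling `(y, t) ↦ (S y / √s, t / s)`. -/
def parabolicScaling (s : ℝ) :
    (EuclideanSpace ℝ (Fin m) × ℝ) →ₗ[ℝ] (EuclideanSpace ℝ (Fin m) × ℝ) :=
  LinearMap.prodMap ((√s)⁻¹ • S) (s⁻¹ • LinearMap.id)

variable {S}

theorem parabolicScaling_preimage {s : ℝ} (hs : 0 < s) (τ : ℝ) :
    parabolicScaling S s ⁻¹' paraboloidCap m τ = ellipticCap S (τ * s) := by
  ext ⟨y, t⟩
  simp only [parabolicScaling, paraboloidCap, ellipticCap, mem_preimage, mem_ofPred_eq,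
    LinearMap.prodMap_apply, LinearMap.smul_apply, LinearMap.id_apply, norm_smul, norm_inv,
    Real.norm_of_nonneg (Real.sqrt_nonneg s), mul_pow, inv_pow, Real.sq_sqrt hs.le, smul_eq_mul]
  refine and_congr ?_ ?_
  · rw [← mul_assoc, mul_comm (1 / 2) s⁻¹, mul_assoc]
    exact mul_le_mul_iff_right₀ (inv_pos.2 hs)
  · rw [inv_mul_le_iff₀ hs, mul_comm]

theorem volume_preimage_parabolicScaling (hS : LinearMap.det S ≠ 0) {s : ℝ} (hs : 0 < s)
    (T : Set (EuclideanSpace ℝ (Fin m) × ℝ)) :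
    volume (parabolicScaling S s ⁻¹' T) =
      ENNReal.ofReal (s ^ (((m : ℝ) + 2) / 2) / |LinearMap.det S|) * volume T := by
  have hdet : LinearMap.det (parabolicScaling S s) = (√s)⁻¹ ^ m * LinearMap.det S * s⁻¹ := by
    simp [parabolicScaling, LinearMap.det_prodMap, LinearMap.det_smul]
  have h0 : LinearMap.det (parabolicScaling S s) ≠ 0 := by
    rw [hdet]
    have := Real.sqrt_pos.2 hs
    positivity
  have : (volume : Measure (EuclideanSpace ℝ (Fin m) × ℝ)).IsAddHaarMeasure := by
    rw [Measure.volume_eq_prod]; infer_instance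
  rw [Measure.addHaar_preimage_linearMap _ h0, hdet]
  congr 2
  have e : (√s) ^ m * s = s ^ (((m : ℝ) + 2) / 2) := by
    rw [Real.sqrt_eq_rpow, ← Real.rpow_natCast, ← Real.rpow_mul hs.le]
    nth_rw 2 [← Real.rpow_one s]
    rw [← Real.rpow_add hs]
    congr 1; ring
  rw [← e, abs_inv, abs_mul, abs_mul, abs_of_pos (inv_pos.2 hs), abs_of_nonneg (by positivity)]
  have := Real.sqrt_pos.2 hs
  have := abs_pos.2 hS
  rw [inv_pow]
  field_simp

theorem volume_ellipticCap [NeZero m] (hS : LinearMap.det S ≠ 0) {s : ℝ} (hs : 0 < s) :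
    volume (ellipticCap S s) =
      ENNReal.ofReal (capConst (m + 1) / |LinearMap.det S| * s ^ (((m : ℝ) + 2) / 2)) := by
  rw [← one_mul s, ← parabolicScaling_preimage hs, volume_preimage_parabolicScaling hS hs,
    volume_paraboloidCap zero_le_one, ← ENNReal.ofReal_mul (by positivity), Real.one_rpow, one_mul]
  congr 1; ring

/-- A half-space through `(0, s)` cuts off from the elliptic paraboloid, truncated at height
`10 s`, at least the volume of the horizontal cap of height `s`. -/
theorem le_volume_ellipticCap_inter [NeZero m] (hS : LinearMap.det S ≠ 0) {s : ℝ} (hs : 0 < s)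
    (ℓ : EuclideanSpace ℝ (Fin m) →ₗ[ℝ] ℝ) (β : ℝ) :
    ENNReal.ofReal (capConst (m + 1) / |LinearMap.det S| * s ^ (((m : ℝ) + 2) / 2)) ≤
      volume (ellipticCap S (10 * s) ∩ {p | 0 ≤ ℓ p.1 + β * (s - p.2)}) := by
  have hsq := Real.sqrt_pos.2 hs
  let e := LinearEquiv.ofIsUnitDet (f := S) (v := Module.Free.chooseBasis ℝ _)
    (v' := Module.Free.chooseBasis ℝ _)
    (by rw [LinearMap.det_toMatrix]; exact hS.isUnit)
  have he : ∀ y, e.symm (S y) = y := fun y => e.symm_apply_apply y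
  -- In the rescaled coordinates `S y / √s` the functional `ℓ` becomes `√s · ℓ ∘ S⁻¹`, and `β`
  -- becomes `β s`.
  let ℓ' : EuclideanSpace ℝ (Fin m) →L[ℝ] ℝ :=
    LinearMap.toContinuousLinearMap (√s • ℓ ∘ₗ (e.symm : _ →ₗ[ℝ] _))
  obtain ⟨b, hb⟩ : ∃ b, ∀ w, inner ℝ b w = ℓ' w :=
    ⟨(InnerProductSpace.toDual ℝ _).symm ℓ', fun w => InnerProductSpace.toDual_symm_apply⟩
  have hset : parabolicScaling S s ⁻¹'
      (paraboloidCap m 10 ∩ {p | 0 ≤ inner ℝ b p.1 + (β * s) * (1 - p.2)}) =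
      ellipticCap S (10 * s) ∩ {p | 0 ≤ ℓ p.1 + β * (s - p.2)} := by
    rw [preimage_inter, parabolicScaling_preimage hs]
    congr 1
    ext ⟨y, t⟩
    simp only [parabolicScaling, mem_preimage, mem_ofPred_eq, LinearMap.prodMap_apply,
      LinearMap.smul_apply, LinearMap.id_apply, hb, smul_eq_mul]
    have : ℓ' ((√s)⁻¹ • S y) = ℓ y := by
      simp [ℓ', he, hsq.ne']
    rw [this]
    have : β * s * (1 - s⁻¹ * t) = β * (s - t) := by field_simp
    rw [this]
  rw [← hset, volume_preimage_parabolicScaling hS hs]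
  refine le_trans (le_of_eq ?_) (mul_le_mul_right (volume_paraboloidCap_one_le b (β * s)) _)
  rw [volume_paraboloidCap zero_le_one, ← ENNReal.ofReal_mul (by positivity), Real.one_rpow]
  congr 1; ring

end ParaboloidVolume

/-! ### Isometric coordinates adapted to a normal direction -/

section HyperplaneChart

variable {m : ℕ} {u : EuclideanSpace ℝ (Fin (m + 1))}

/-- Coordinates `(y, t) ↦ y - t u` adapted to the hyperplane orthogonal to `u`. -/
def hyperplaneChart (e : EuclideanSpace ℝ (Fin m) ≃ₗᵢ[ℝ] (ℝ ∙ u)ᗮ) :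
    (EuclideanSpace ℝ (Fin m) × ℝ) →ₗ[ℝ] EuclideanSpace ℝ (Fin (m + 1)) :=
  (((ℝ ∙ u)ᗮ.subtype ∘ₗ e.toLinearEquiv.toLinearMap) ∘ₗ LinearMap.fst ℝ _ _) -
    (LinearMap.toSpanSingleton ℝ _ u) ∘ₗ LinearMap.snd ℝ _ _

variable (e : EuclideanSpace ℝ (Fin m) ≃ₗᵢ[ℝ] (ℝ ∙ u)ᗮ)

theorem hyperplaneChart_apply (y : EuclideanSpace ℝ (Fin m)) (t : ℝ) :
    hyperplaneChart e (y, t) = (e y : EuclideanSpace ℝ (Fin (m + 1))) - t • u := by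
  simp [hyperplaneChart, LinearMap.toSpanSingleton_apply]

theorem inner_coe_orthogonal {E : Type*} [NormedAddCommGroup E] [InnerProductSpace ℝ E]
    {u : E} (y : (ℝ ∙ u)ᗮ) : inner ℝ u (y : E) = 0 :=
  Submodule.mem_orthogonal_singleton_iff_inner_right.1 y.2

theorem norm_hyperplaneChart_sq (hu : ‖u‖ = 1) (p : EuclideanSpace ℝ (Fin m) × ℝ) :
    ‖hyperplaneChart e p‖ ^ 2 = ‖p.1‖ ^ 2 + p.2 ^ 2 := by
  obtain ⟨y, t⟩ := p
  rw [hyperplaneChart_apply, norm_sub_sq_real, inner_smul_right,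
    real_inner_comm, inner_coe_orthogonal, norm_smul, hu]
  have : ‖(e y : EuclideanSpace ℝ (Fin (m + 1)))‖ = ‖y‖ := e.norm_map y
  simp [this]

theorem measurePreserving_hyperplaneChart (hu : ‖u‖ = 1) :
    MeasurePreserving (hyperplaneChart e) := by
  let f : WithLp 2 (EuclideanSpace ℝ (Fin m) × ℝ) →ₗᵢ[ℝ] EuclideanSpace ℝ (Fin (m + 1)) :=
    { toLinearMap := hyperplaneChart e ∘ₗ (WithLp.linearEquiv 2 ℝ _).toLinearMap
      norm_map' := fun p => by
        rw [← sq_eq_sq₀ (norm_nonneg _) (norm_nonneg _), WithLp.prod_norm_sq_eq_of_L2]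
        simpa using norm_hyperplaneChart_sq e hu p.ofLp }
  have hrank : Module.finrank ℝ (WithLp 2 (EuclideanSpace ℝ (Fin m) × ℝ)) =
      Module.finrank ℝ (EuclideanSpace ℝ (Fin (m + 1))) := by
    rw [(WithLp.linearEquiv 2 ℝ _).finrank_eq]
    simp
  have h := (f.toLinearIsometryEquiv hrank).measurePreserving.comp
    (WithLp.volume_preserving_toLp (EuclideanSpace ℝ (Fin m)) ℝ)
  exact h

theorem exists_hyperplaneChart_eq (hu : ‖u‖ = 1) (x : EuclideanSpace ℝ (Fin (m + 1))) :
    ∃ y, hyperplaneChart e (y, -inner ℝ u x) = x := by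
  have hmem : x - (inner ℝ u x) • u ∈ (ℝ ∙ u)ᗮ := by
    rw [Submodule.mem_orthogonal_singleton_iff_inner_right, inner_sub_right, inner_smul_right,
      real_inner_self_eq_norm_sq, hu]
    ring
  refine ⟨e.symm ⟨_, hmem⟩, ?_⟩
  rw [hyperplaneChart_apply]
  simp

theorem exists_orthogonalEquiv (hu : ‖u‖ = 1) :
    Nonempty (EuclideanSpace ℝ (Fin m) ≃ₗᵢ[ℝ] (ℝ ∙ u)ᗮ) := by
  have : Fact (Module.finrank ℝ (EuclideanSpace ℝ (Fin (m + 1))) = m + 1) := ⟨by simp⟩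
  have hu0 : u ≠ 0 := by rintro rfl; simp at hu
  exact ⟨(OrthonormalBasis.fromOrthogonalSpanSingleton (𝕜 := ℝ) m hu0).repr.symm⟩

end HyperplaneChart

/-! ### Null cones and null sets of the sphere -/

section Cones

theorem norm_inv_norm_smul_sub_le {E : Type*} [NormedAddCommGroup E] [NormedSpace ℝ E]
    {z w : E} {τ : ℝ} (hτ : 0 < τ) (hz : τ ≤ ‖z‖) (hw : τ ≤ ‖w‖) :
    ‖‖z‖⁻¹ • z - ‖w‖⁻¹ • w‖ ≤ 2 / τ * ‖z - w‖ := by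
  have hz0 : 0 < ‖z‖ := hτ.trans_le hz
  have hw0 : 0 < ‖w‖ := hτ.trans_le hw
  have e1 : ‖z‖⁻¹ • z - ‖w‖⁻¹ • w = ‖z‖⁻¹ • (z - w) + (‖z‖⁻¹ - ‖w‖⁻¹) • w := by
    rw [smul_sub, sub_smul]; abel
  have e2 : ‖(‖z‖⁻¹ - ‖w‖⁻¹) • w‖ = ‖z‖⁻¹ * |‖w‖ - ‖z‖| := by
    rw [norm_smul, Real.norm_eq_abs, show ‖z‖⁻¹ - ‖w‖⁻¹ = ‖z‖⁻¹ * ((‖w‖ - ‖z‖) * ‖w‖⁻¹) by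
      field_simp, abs_mul, abs_mul, abs_of_pos (inv_pos.2 hz0), abs_of_pos (inv_pos.2 hw0)]
    field_simp
  have h3 : |‖w‖ - ‖z‖| ≤ ‖z - w‖ := by
    rw [abs_sub_comm]; exact abs_norm_sub_norm_le z w
  calc ‖‖z‖⁻¹ • z - ‖w‖⁻¹ • w‖ ≤ ‖‖z‖⁻¹ • (z - w)‖ + ‖(‖z‖⁻¹ - ‖w‖⁻¹) • w‖ := by
        rw [e1]; exact norm_add_le _ _
    _ = ‖z‖⁻¹ * (‖z - w‖ + |‖w‖ - ‖z‖|) := by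
        rw [e2, norm_smul, norm_inv, norm_norm]; ring
    _ ≤ τ⁻¹ * (‖z - w‖ + ‖z - w‖) := by
        gcongr
    _ = 2 / τ * ‖z - w‖ := by ring

variable {m : ℕ}

theorem hausdorffMeasure_eq_zero_of_volume {A : Set (EuclideanSpace ℝ (Fin m))}
    (h : volume A = 0) : Measure.hausdorffMeasure (m : ℝ) A = 0 := by
  have : (Measure.hausdorffMeasure (m : ℝ) :
      Measure (EuclideanSpace ℝ (Fin m))).IsAddHaarMeasure := by
    simpa using isAddHaarMeasure_hausdorffMeasure (E := EuclideanSpace ℝ (Fin m))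
  exact Measure.absolutelyContinuous_isAddHaarMeasure _ volume h

theorem volume_eq_zero_of_hausdorffMeasure {A : Set (EuclideanSpace ℝ (Fin m))}
    (h : Measure.hausdorffMeasure (m : ℝ) A = 0) : volume A = 0 := by
  have : (Measure.hausdorffMeasure (m : ℝ) :
      Measure (EuclideanSpace ℝ (Fin m))).IsAddHaarMeasure := by
    simpa using isAddHaarMeasure_hausdorffMeasure (E := EuclideanSpace ℝ (Fin m))
  exact Measure.absolutelyContinuous_isAddHaarMeasure volume (Measure.hausdorffMeasure (m : ℝ)) h

theorem volume_image_eq_zero_of_lipschitz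
    {f : EuclideanSpace ℝ (Fin m) → EuclideanSpace ℝ (Fin m)} {C : ℝ≥0} (hf : LipschitzWith C f)
    {A : Set (EuclideanSpace ℝ (Fin m))} (hA : volume A = 0) : volume (f '' A) = 0 := by
  apply volume_eq_zero_of_hausdorffMeasure
  refine le_antisymm ((hf.hausdorffMeasure_image_le (Nat.cast_nonneg m) A).trans ?_) (zero_le)
  rw [hausdorffMeasure_eq_zero_of_volume hA, mul_zero]

/-- By Fubini a null set meets almost every hyperplane orthogonal to `v` in an `m`-dimensional null
set. For a cone, one such hyperplane on the positive side already sees every ray of the open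
hemisphere, and the radial projection onto the sphere is Lipschitz on it. -/
theorem hausdorffMeasure_cone_inter_halfSphere {B : Set (EuclideanSpace ℝ (Fin (m + 1)))}
    (hB : volume B = 0) (hcone : ∀ c : ℝ, 0 < c → ∀ x ∈ B, c • x ∈ B)
    {v : EuclideanSpace ℝ (Fin (m + 1))} (hv : ‖v‖ = 1) :
    Measure.hausdorffMeasure (m : ℝ) (B ∩ Metric.sphere 0 1 ∩ {x | 0 < inner ℝ v x}) = 0 := by
  obtain ⟨e⟩ := exists_orthogonalEquiv hv
  have h0 : volume (hyperplaneChart e ⁻¹' B) = 0 :=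
    (measurePreserving_hyperplaneChart e hv).quasiMeasurePreserving.preimage_null hB
  have h1 : volume ((Prod.swap : ℝ × EuclideanSpace ℝ (Fin m) → _) ⁻¹'
      (hyperplaneChart e ⁻¹' B)) = 0 :=
    (Measure.measurePreserving_swap (μ := (volume : Measure ℝ))
      (ν := (volume : Measure (EuclideanSpace ℝ (Fin m))))).quasiMeasurePreserving.preimage_null h0
  have h2 := Measure.measure_ae_null_of_prod_null h1
  -- In the chart, `t` is minus the height along `v`, so `t < 0` selects a hyperplane on the
  -- positive side, at distance `-t` from the origin.
  obtain ⟨t, ht, hWt⟩ := Measure.exists_mem_of_measure_ne_zero_of_ae (μ := (volume : Measure ℝ))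
    (s := Iio 0) (by simp) (ae_restrict_of_ae h2)
  have ht : t < 0 := ht
  set W : Set (EuclideanSpace ℝ (Fin m)) := {y | hyperplaneChart e (y, t) ∈ B}
  have hW : volume W = 0 := hWt
  let N : EuclideanSpace ℝ (Fin m) → EuclideanSpace ℝ (Fin (m + 1)) := fun y =>
    ‖hyperplaneChart e (y, t)‖⁻¹ • hyperplaneChart e (y, t)
  have hlow : ∀ y, -t ≤ ‖hyperplaneChart e (y, t)‖ := fun y => by
    apply le_of_sq_le_sq _ (norm_nonneg _)
    rw [norm_hyperplaneChart_sq e hv]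
    nlinarith [sq_nonneg ‖y‖]
  have hN : LipschitzWith (2 / (-t)).toNNReal N := by
    apply LipschitzWith.of_dist_le_mul
    intro y y'
    have ht' : 0 < -t := by linarith
    rw [dist_eq_norm, Real.coe_toNNReal _ (by positivity)]
    refine (norm_inv_norm_smul_sub_le ht' (hlow y) (hlow y')).trans (le_of_eq ?_)
    congr 1
    rw [← map_sub, dist_eq_norm, ← sq_eq_sq₀ (norm_nonneg _) (norm_nonneg _),
      norm_hyperplaneChart_sq e hv]
    simp
  have hsub : B ∩ Metric.sphere 0 1 ∩ {x | 0 < inner ℝ v x} ⊆ N '' W := by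
    rintro x ⟨⟨hxB, hx1⟩, hvx⟩
    have hvx : 0 < inner ℝ v x := hvx
    have hx1 : ‖x‖ = 1 := by simpa using hx1
    have hc : 0 < -t / inner ℝ v x := div_pos (by linarith) hvx
    obtain ⟨y, hy⟩ := exists_hyperplaneChart_eq e hv ((-t / inner ℝ v x) • x)
    rw [inner_smul_right, div_mul_cancel₀ _ hvx.ne', neg_neg] at hy
    refine ⟨y, ?_, ?_⟩
    · change hyperplaneChart e (y, t) ∈ B
      rw [hy]; exact hcone _ hc _ hxB
    · change ‖hyperplaneChart e (y, t)‖⁻¹ • hyperplaneChart e (y, t) = x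
      rw [hy, norm_smul, hx1, mul_one, Real.norm_of_nonneg hc.le, inv_smul_smul₀ hc.ne']
  refine measure_mono_null hsub
    (le_antisymm ((hN.hausdorffMeasure_image_le (Nat.cast_nonneg m) W).trans ?_) (zero_le))
  rw [hausdorffMeasure_eq_zero_of_volume hW, mul_zero]

/-- A cone of Lebesgue measure zero meets the unit sphere in a null set. -/
theorem hausdorffMeasure_cone_inter_sphere {B : Set (EuclideanSpace ℝ (Fin (m + 1)))}
    (hB : volume B = 0) (hcone : ∀ c : ℝ, 0 < c → ∀ x ∈ B, c • x ∈ B) :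
    Measure.hausdorffMeasure (m : ℝ) (B ∩ Metric.sphere 0 1) = 0 := by
  let v : Fin (m + 1) × Bool → EuclideanSpace ℝ (Fin (m + 1)) := fun p =>
    bif p.2 then EuclideanSpace.single p.1 1 else -EuclideanSpace.single p.1 1
  have hv : ∀ p, ‖v p‖ = 1 := by
    rintro ⟨i, _ | _⟩ <;> simp [v]
  have hsub : B ∩ Metric.sphere 0 1 ⊆
      ⋃ p, B ∩ Metric.sphere 0 1 ∩ {x | 0 < inner ℝ (v p) x} := by
    intro x hx
    obtain ⟨i, hi⟩ : ∃ i, x i ≠ 0 := by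
      by_contra! h
      have : x = 0 := by ext i; exact h i
      rw [this] at hx
      simpa using hx.2
    rw [mem_iUnion]
    rcases lt_or_gt_of_ne hi with h | h
    · exact ⟨(i, false), hx, by simpa [v, EuclideanSpace.inner_single_left] using h⟩
    · exact ⟨(i, true), hx, by simpa [v, EuclideanSpace.inner_single_left] using h⟩
  exact measure_mono_null hsub
    (measure_iUnion_null fun p => hausdorffMeasure_cone_inter_halfSphere hB hcone (hv p))

end Cones

/-! ### Homogeneous Lipschitz extension of the Gauss map -/

section RadialExtension

variable {E : Type*} [NormedAddCommGroup E] [NormedSpace ℝ E]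

/-- The gauge of `K` with respect to the point `x₀`. -/
def gaugeAt (K : Set E) (x₀ : E) (z : E) : ℝ := gauge ((fun w => x₀ + w) ⁻¹' K) z

/-- The positively homogeneous extension of a map `n` on the boundary of `K`, centred at `x₀`. -/
def radialExtension (K : Set E) (x₀ : E) (n : E → E) (z : E) : E :=
  gaugeAt K x₀ z • n (x₀ + (gaugeAt K x₀ z)⁻¹ • z)

variable {K : Set E} {x₀ : E} {n : E → E}

theorem gaugeAt_smul {c : ℝ} (hc : 0 ≤ c) (z : E) :
    gaugeAt K x₀ (c • z) = c * gaugeAt K x₀ z := by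
  simp [gaugeAt, gauge_smul_of_nonneg hc]

theorem radialExtension_smul {c : ℝ} (hc : 0 < c) (z : E) :
    radialExtension K x₀ n (c • z) = c • radialExtension K x₀ n z := by
  unfold radialExtension
  have h : (c * gaugeAt K x₀ z)⁻¹ * c = (gaugeAt K x₀ z)⁻¹ := by
    rw [mul_inv, mul_right_comm, inv_mul_cancel₀ hc.ne', one_mul]
  rw [gaugeAt_smul hc.le, smul_smul, h, mul_smul]

theorem convex_preimage_add_left (hK : Convex ℝ K) : Convex ℝ ((fun w => x₀ + w) ⁻¹' K) :=
  hK.translate_preimage_right x₀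

theorem preimage_add_left_mem_nhds {E : Type*} [NormedAddCommGroup E] {K : Set E} {x₀ : E}
    (hx₀ : x₀ ∈ interior K) : (fun w => x₀ + w) ⁻¹' K ∈ 𝓝 0 := by
  apply (continuous_const_add x₀).continuousAt.preimage_mem_nhds
  rw [add_zero]
  exact mem_interior_iff_mem_nhds.1 hx₀

theorem gaugeAt_eq_one_iff (hK : Convex ℝ K) (hx₀ : x₀ ∈ interior K) {z : E} :
    gaugeAt K x₀ z = 1 ↔ x₀ + z ∈ frontier K := by
  rw [gaugeAt, gauge_eq_one_iff_mem_frontier (convex_preimage_add_left hK)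
    (preimage_add_left_mem_nhds hx₀)]
  have := (Homeomorph.addLeft x₀).preimage_frontier K
  rw [Homeomorph.coe_addLeft] at this
  rw [← this]; rfl

theorem radialExtension_sub (hK : Convex ℝ K) (hx₀ : x₀ ∈ interior K) {p : E}
    (hp : p ∈ frontier K) : radialExtension K x₀ n (p - x₀) = n p := by
  have : gaugeAt K x₀ (p - x₀) = 1 := by
    rw [gaugeAt_eq_one_iff hK hx₀]; simpa using hp
  simp [radialExtension, this]

theorem gaugeAt_zero : gaugeAt K x₀ 0 = 0 := by simp [gaugeAt]

theorem norm_le_mul_gaugeAt (hx₀ : x₀ ∈ interior K) {R : ℝ} (hR : 0 < R)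
    (hKR : K ⊆ Metric.closedBall x₀ R) (z : E) : ‖z‖ ≤ R * gaugeAt K x₀ z := by
  have h1 : (fun w => x₀ + w) ⁻¹' K ⊆ Metric.closedBall 0 R := by
    intro w hw
    simpa using hKR hw
  have := le_gauge_of_subset_closedBall
    (absorbent_nhds_zero (preimage_add_left_mem_nhds hx₀)) hR.le h1 (x := z)
  rw [div_le_iff₀ hR] at this
  rw [mul_comm]; exact this

/-- The radial projection to the boundary has local Lipschitz constant of order the inverse of the
gauge, which blows up at the centre; the factor `gaugeAt` in the extension compensates exactly. The
gauge itself is Lipschitz because the centre is interior. -/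
theorem exists_lipschitzWith_radialExtension (hK : Convex ℝ K) (hKb : Bornology.IsBounded K)
    (hx₀ : x₀ ∈ interior K) (hn1 : ∀ x ∈ frontier K, ‖n x‖ = 1) {L : ℝ≥0}
    (hL : LipschitzOnWith L n (frontier K)) :
    ∃ C : ℝ≥0, LipschitzWith C (radialExtension K x₀ n) := by
  obtain ⟨G, hG⟩ := (convex_preimage_add_left (x₀ := x₀) hK).lipschitz_gauge
    (preimage_add_left_mem_nhds hx₀)
  have hG : LipschitzWith G (gaugeAt K x₀) := hG
  obtain ⟨R, hR, hKR⟩ := hKb.subset_closedBall_lt 0 x₀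
  have hle := norm_le_mul_gaugeAt hx₀ hR hKR
  have hpos : ∀ z, z ≠ 0 → 0 < gaugeAt K x₀ z := fun z hz => by
    have h1 := hle z
    have h2 := norm_pos_iff.2 hz
    by_contra h
    nlinarith
  have hfr : ∀ z, z ≠ 0 → x₀ + (gaugeAt K x₀ z)⁻¹ • z ∈ frontier K := fun z hz => by
    rw [← gaugeAt_eq_one_iff hK hx₀, gaugeAt_smul (inv_nonneg.2 (hpos z hz).le),
      inv_mul_cancel₀ (hpos z hz).ne']
  have hGd : ∀ z w, |gaugeAt K x₀ z - gaugeAt K x₀ w| ≤ G * ‖z - w‖ := fun z w => by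
    have := hG.dist_le_mul z w
    rwa [Real.dist_eq, dist_eq_norm] at this
  refine ⟨(G + L * (1 + R * G)).toNNReal, LipschitzWith.of_dist_le_mul fun z w => ?_⟩
  rw [Real.coe_toNNReal _ (by positivity), dist_eq_norm, dist_eq_norm]
  have hbig : (G : ℝ) * ‖z - w‖ ≤ (G + L * (1 + R * G)) * ‖z - w‖ := by
    gcongr
    have : 0 ≤ (L : ℝ) * (1 + R * G) := by positivity
    linarith
  have hnorm : ∀ z, ‖radialExtension K x₀ n z‖ = gaugeAt K x₀ z := fun z => by
    by_cases hz : z = 0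
    · subst hz; simp [radialExtension, gaugeAt_zero]
    · rw [radialExtension, norm_smul, hn1 _ (hfr z hz), mul_one, Real.norm_of_nonneg (hpos z hz).le]
  by_cases hz : z = 0
  · subst hz
    have h0 : radialExtension K x₀ n 0 = 0 := by simp [radialExtension, gaugeAt_zero]
    rw [h0, zero_sub, norm_neg, hnorm]
    refine le_trans ?_ hbig
    have := hGd w 0
    rw [gaugeAt_zero, sub_zero, sub_zero] at this
    rw [zero_sub, norm_neg]
    exact (le_abs_self _).trans this
  by_cases hw : w = 0
  · subst hw
    have h0 : radialExtension K x₀ n 0 = 0 := by simp [radialExtension, gaugeAt_zero]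
    rw [h0, sub_zero, hnorm]
    refine le_trans ?_ hbig
    have := hGd z 0
    rw [gaugeAt_zero, sub_zero] at this
    exact (le_abs_self _).trans this
  set a := gaugeAt K x₀ z with ha
  set b := gaugeAt K x₀ w with hb
  have ha0 : 0 < a := hpos z hz
  have hb0 : 0 < b := hpos w hw
  -- Product rule for differences: the change of the gauge times a unit vector, plus the gauge times
  -- the change of the normal.
  have hdec : radialExtension K x₀ n z - radialExtension K x₀ n w =
      (a - b) • n (x₀ + a⁻¹ • z) + b • (n (x₀ + a⁻¹ • z) - n (x₀ + b⁻¹ • w)) := by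
    simp only [radialExtension, ← ha, ← hb]
    rw [sub_smul, smul_sub]; abel
  have h1 : ‖(a - b) • n (x₀ + a⁻¹ • z)‖ ≤ G * ‖z - w‖ := by
    rw [norm_smul, hn1 _ (hfr z hz), mul_one]; exact hGd z w
  have h2 : ‖n (x₀ + a⁻¹ • z) - n (x₀ + b⁻¹ • w)‖ ≤ L * ‖a⁻¹ • z - b⁻¹ • w‖ := by
    have := hL.dist_le_mul _ (hfr z hz) _ (hfr w hw)
    rwa [dist_eq_norm, dist_eq_norm, add_sub_add_left_eq_sub] at this
  have h3 : b * ‖a⁻¹ • z - b⁻¹ • w‖ ≤ (1 + R * G) * ‖z - w‖ := by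
    have e1 : b • (a⁻¹ • z - b⁻¹ • w) = (z - w) + ((b - a) * a⁻¹) • z := by
      rw [smul_sub, smul_smul, smul_smul, mul_inv_cancel₀ hb0.ne', one_smul, sub_mul,
        mul_inv_cancel₀ ha0.ne', sub_smul, one_smul]
      abel
    calc b * ‖a⁻¹ • z - b⁻¹ • w‖ = ‖b • (a⁻¹ • z - b⁻¹ • w)‖ := by
          rw [norm_smul, Real.norm_of_nonneg hb0.le]
      _ ≤ ‖z - w‖ + ‖((b - a) * a⁻¹) • z‖ := by rw [e1]; exact norm_add_le _ _
      _ = ‖z - w‖ + |a - b| * (a⁻¹ * ‖z‖) := by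
          rw [norm_smul, norm_mul, Real.norm_eq_abs, abs_sub_comm,
            Real.norm_of_nonneg (inv_nonneg.2 ha0.le)]; ring
      _ ≤ ‖z - w‖ + (G * ‖z - w‖) * R := by
          have : a⁻¹ * ‖z‖ ≤ R := by
            rw [inv_mul_le_iff₀ ha0, mul_comm]; exact hle z
          gcongr
          exact hGd z w
      _ = (1 + R * G) * ‖z - w‖ := by ring
  calc ‖radialExtension K x₀ n z - radialExtension K x₀ n w‖
      ≤ G * ‖z - w‖ + b * (L * ‖a⁻¹ • z - b⁻¹ • w‖) := by
        rw [hdec]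
        refine (norm_add_le _ _).trans (add_le_add h1 ?_)
        rw [norm_smul, Real.norm_of_nonneg hb0.le]
        gcongr
    _ = G * ‖z - w‖ + L * (b * ‖a⁻¹ • z - b⁻¹ • w‖) := by ring
    _ ≤ G * ‖z - w‖ + L * ((1 + R * G) * ‖z - w‖) := by gcongr
    _ = (G + L * (1 + R * G)) * ‖z - w‖ := by ring

/-- A map homogeneous of degree one has a derivative homogeneous of degree zero, so
differentiability and invertibility persist along rays and the exceptional set is a cone. -/
theorem hasFDerivAt_smul_of_homogeneous {Φ : E → E}
    (hΦ : ∀ c : ℝ, 0 < c → ∀ z, Φ (c • z) = c • Φ z) {c : ℝ} (hc : 0 < c) {z : E}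
    {D : E →L[ℝ] E} (h : HasFDerivAt Φ D z) : HasFDerivAt Φ D (c • z) := by
  have e : Φ = fun w => c • Φ (c⁻¹ • w) := by
    funext w
    rw [← hΦ c hc, smul_inv_smul₀ hc.ne']
  have h' : HasFDerivAt Φ D (c⁻¹ • (c • z)) := by rwa [inv_smul_smul₀ hc.ne']
  have h1 : HasFDerivAt (fun w : E => c⁻¹ • w) (c⁻¹ • ContinuousLinearMap.id ℝ E) (c • z) :=
    (hasFDerivAt_id _).const_smul c⁻¹
  have h2 := (h'.comp (c • z) h1).const_smul c
  have hcomp : c • D ∘L (c⁻¹ • ContinuousLinearMap.id ℝ E) = D := by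
    ext w
    simp [smul_smul, hc.ne']
  rw [hcomp] at h2
  rw [e]
  exact h2

end RadialExtension

/-! ### Exceptional directions via Rademacher and Sard -/

section AlmostEverywhere

variable {m : ℕ}

/-- For almost every direction `u`, the preimages of `u` under a homogeneous Lipschitz map are
points where the derivative exists and is invertible. -/
theorem ae_sphere_hasFDerivAt_preimage
    {Φ : EuclideanSpace ℝ (Fin (m + 1)) → EuclideanSpace ℝ (Fin (m + 1))} {C : ℝ≥0}
    (hΦ : LipschitzWith C Φ) (hhom : ∀ c : ℝ, 0 < c → ∀ z, Φ (c • z) = c • Φ z) :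
    ∀ᵐ u ∂((Measure.hausdorffMeasure (m : ℝ) :
        Measure (EuclideanSpace ℝ (Fin (m + 1)))).restrict (Metric.sphere 0 1)),
      ∀ z, Φ z = u → ∃ D : EuclideanSpace ℝ (Fin (m + 1)) →L[ℝ] EuclideanSpace ℝ (Fin (m + 1)),
        HasFDerivAt Φ D z ∧ D.det ≠ 0 := by
  set Bad : Set (EuclideanSpace ℝ (Fin (m + 1))) :=
    {z | ¬ ∃ D : EuclideanSpace ℝ (Fin (m + 1)) →L[ℝ] EuclideanSpace ℝ (Fin (m + 1)),
      HasFDerivAt Φ D z ∧ D.det ≠ 0} with hBad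
  have hnull : volume (Φ '' Bad) = 0 := by
    have hsub : Φ '' Bad ⊆ Φ '' {z | ¬ DifferentiableAt ℝ Φ z} ∪
        Φ '' {z | DifferentiableAt ℝ Φ z ∧ (fderiv ℝ Φ z).det = 0} := by
      rw [← image_union]
      apply image_mono
      intro z hz
      by_cases hd : DifferentiableAt ℝ Φ z
      · refine Or.inr ⟨hd, ?_⟩
        by_contra hdet
        exact hz ⟨_, hd.hasFDerivAt, hdet⟩
      · exact Or.inl hd
    refine measure_mono_null hsub (measure_union_null ?_ ?_)
    -- Rademacher: the points of non-differentiability are null, and Lipschitz maps preserve null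
    -- sets.
    · exact volume_image_eq_zero_of_lipschitz hΦ (ae_iff.1 hΦ.ae_differentiableAt)
    -- Sard-type statement: the image of the set where the Jacobian vanishes is null.
    · exact addHaar_image_eq_zero_of_det_fderivWithin_eq_zero volume
        (fun z hz => hz.1.hasFDerivAt.hasFDerivWithinAt) (fun z hz => hz.2)
  have hcone : ∀ c : ℝ, 0 < c → ∀ x ∈ Φ '' Bad, c • x ∈ Φ '' Bad := by
    rintro c hc _ ⟨z, hz, rfl⟩
    refine ⟨c • z, ?_, hhom c hc z⟩
    rintro ⟨D, hD, hdet⟩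
    refine hz ⟨D, ?_, hdet⟩
    have := hasFDerivAt_smul_of_homogeneous hhom (inv_pos.2 hc) hD
    rwa [inv_smul_smul₀ hc.ne'] at this
  rw [ae_restrict_iff' Metric.isClosed_sphere.measurableSet, ae_iff]
  refine measure_mono_null ?_ (hausdorffMeasure_cone_inter_sphere hnull hcone)
  intro u hu
  simp only [Classical.not_imp, not_forall, mem_ofPred_eq] at hu
  obtain ⟨hu1, z, hz, hbad⟩ := hu
  exact ⟨⟨z, hbad, hz⟩, hu1⟩

end AlmostEverywhere

/-! ### The boundary as a graph over the tangent hyperplane -/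

section BoundaryGraph

variable {E : Type*} [NormedAddCommGroup E] [InnerProductSpace ℝ E]
  {K : Set E} {x u : E}

/-- Below a boundary point with a unique normal `u`, the direction `-u` points into the interior. -/
theorem exists_sub_smul_mem_interior [CompleteSpace E] (hconv : Convex ℝ K) (hint : (interior K).Nonempty)
    (hxK : x ∈ K) (hu : ∀ v, IsOuterUnitNormal K x v ↔ v = u) :
    ∃ t : ℝ, 0 < t ∧ x - t • u ∈ interior K := by
  by_contra! h
  -- If the ray below `x` misses the interior, Hahn–Banach separates the two. Letting `t → 0`, the
  -- separating functional supports `K` at `x`, so it is a positive multiple of `⟨u, ·⟩` by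
  -- uniqueness of the normal. It then strictly decreases along `-u`, contradicting the separation.
  have hR : Convex ℝ {p : E | ∃ t : ℝ, 0 < t ∧ p = x - t • u} := by
    rintro _ ⟨s, hs, rfl⟩ _ ⟨t, ht, rfl⟩ a b ha hb hab
    refine ⟨a * s + b * t, ?_, ?_⟩
    · rcases ha.eq_or_lt with rfl | ha
      · have : b = 1 := by linarith
        subst this; simpa using ht
      · have := mul_pos ha hs
        have := mul_nonneg hb ht.le
        linarith
    · have hb' : b = 1 - a := by linarith
      subst hb'
      module
  have hdisj : Disjoint (interior K) {p : E | ∃ t : ℝ, 0 < t ∧ p = x - t • u} := by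
    rw [Set.disjoint_left]
    rintro p hp ⟨t, ht, rfl⟩
    exact h t ht hp
  obtain ⟨f, c, hf1, hf2⟩ := geometric_hahn_banach_open hconv.interior isOpen_interior hR hdisj
  have hKc : ∀ k ∈ K, f k ≤ c := by
    intro k hk
    have hk' : k ∈ closure (interior K) := by
      rw [hconv.closure_interior_eq_closure_of_nonempty_interior hint]
      exact subset_closure hk
    exact closure_minimal (fun a ha => (hf1 a ha).le)
      (isClosed_le f.continuous continuous_const) hk'
  have hray : ∀ t : ℝ, 0 < t → c ≤ f x - t * f u := fun t ht => by
    simpa using hf2 _ ⟨t, ht, rfl⟩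
  have hcx : c ≤ f x := by
    by_contra! hlt
    rcases le_or_gt 0 (f u) with h0 | h0
    · have := hray 1 one_pos; linarith
    · have h1 : 0 < (c - f x) / (2 * (- f u)) := by
        apply div_pos <;> linarith
      have h2 := hray _ h1
      have h3 : (c - f x) / (2 * (- f u)) * f u = - ((c - f x) / 2) := by
        have := h0.ne; field_simp
      rw [h3] at h2
      linarith
  set w := (InnerProductSpace.toDual ℝ E).symm f with hw
  have hfw : ∀ y, inner ℝ w y = f y := fun y => InnerProductSpace.toDual_symm_apply
  have hw0 : w ≠ 0 := by
    intro h0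
    obtain ⟨a, ha⟩ := hint
    have h1 := hf1 a ha
    rw [← hfw, h0, inner_zero_left] at h1
    rw [← hfw, h0, inner_zero_left] at hcx
    linarith
  have hwn : 0 < ‖w‖ := norm_pos_iff.2 hw0
  have hnormal : IsOuterUnitNormal K x (‖w‖⁻¹ • w) := by
    refine ⟨by rw [norm_smul, norm_inv, norm_norm, inv_mul_cancel₀ hwn.ne'], fun y hy => ?_⟩
    rw [inner_smul_left, inner_smul_left, hfw, hfw]
    simp only [conj_trivial]
    have := (hKc y hy).trans hcx
    gcongr
  have hwu := (hu _).1 hnormal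
  have hfu : 0 < f u := by
    rw [← hwu, map_smul, ← hfw, real_inner_self_eq_norm_sq, smul_eq_mul]
    positivity
  have h1 := hray 1 one_pos
  have h2 := hKc x hxK
  linarith

/-- Near a point with a unique normal the boundary is the graph of `localRep` over a ball, and
`K` contains the region between this graph and a parallel hyperplane. -/
structure IsGraphOver (K : Set E) (x u : E) (r t₁ : ℝ) : Prop where
  r_pos : 0 < r
  t_pos : 0 < t₁
  ball_subset : ∀ y : (ℝ ∙ u)ᗮ, ‖y‖ < r → ∀ w : E, ‖w‖ < r → x + (y : E) - t₁ • u + w ∈ K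
  isLeast : ∀ y : (ℝ ∙ u)ᗮ, ‖y‖ < r → IsLeast {t : ℝ | x + (y : E) - t • u ∈ K} (localRep K x u y)
  nonneg : ∀ y : (ℝ ∙ u)ᗮ, ‖y‖ < r → 0 ≤ localRep K x u y

theorem exists_isGraphOver [CompleteSpace E] (hcomp : IsCompact K) (hconv : Convex ℝ K)
    (hint : (interior K).Nonempty) (hxK : x ∈ K) (hu : ∀ v, IsOuterUnitNormal K x v ↔ v = u) :
    ∃ r t₁, IsGraphOver K x u r t₁ := by
  have hun := (hu u).2 rfl
  obtain ⟨t₁, ht₁, hq⟩ := exists_sub_smul_mem_interior hconv hint hxK hu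
  obtain ⟨r, hr, hball⟩ := Metric.isOpen_iff.1 isOpen_interior _ hq
  have hmem : ∀ y : (ℝ ∙ u)ᗮ, ‖y‖ < r / 2 → ∀ w : E, ‖w‖ < r / 2 →
      x + (y : E) - t₁ • u + w ∈ K := fun y hy w hw => by
    apply interior_subset (hball _)
    rw [Metric.mem_ball, dist_eq_norm]
    have : x + (y : E) - t₁ • u + w - (x - t₁ • u) = y + w := by abel
    rw [this]
    have h1 := norm_add_le (y : E) w
    have h2 : ‖(y : E)‖ = ‖y‖ := rfl
    linarith
  have hlow : ∀ y : (ℝ ∙ u)ᗮ, 0 ∈ lowerBounds {t : ℝ | x + (y : E) - t • u ∈ K} := by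
    intro y t ht
    have h1 := hun.2 _ ht
    rw [inner_sub_right, inner_add_right, inner_coe_orthogonal, inner_smul_right,
      real_inner_self_eq_norm_sq, hun.1] at h1
    linarith
  have hleast : ∀ y : (ℝ ∙ u)ᗮ, ‖y‖ < r / 2 →
      IsLeast {t : ℝ | x + (y : E) - t • u ∈ K} (localRep K x u y) := by
    intro y hy
    have hcl : IsClosed {t : ℝ | x + (y : E) - t • u ∈ K} :=
      hcomp.isClosed.preimage (f := fun t : ℝ => x + (y : E) - t • u) (by fun_prop)
    have hne : {t : ℝ | x + (y : E) - t • u ∈ K}.Nonempty :=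
      ⟨t₁, by simpa using hmem y hy 0 (by simpa using half_pos hr)⟩
    exact ⟨hcl.csInf_mem hne ⟨0, hlow y⟩, fun t ht => csInf_le ⟨0, hlow y⟩ ht⟩
  exact ⟨r / 2, t₁, half_pos hr, ht₁, hmem, hleast, fun y hy => hlow y (hleast y hy).1⟩

namespace IsGraphOver

variable {r t₁ : ℝ} (h : IsGraphOver K x u r t₁)
include h

theorem localRep_le {y : (ℝ ∙ u)ᗮ} (hy : ‖y‖ < r) : localRep K x u y ≤ t₁ :=
  (h.isLeast y hy).2 (by simpa using h.ball_subset y hy 0 (by simpa using h.r_pos))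

theorem mem_of_le (hconv : Convex ℝ K) {y : (ℝ ∙ u)ᗮ} (hy : ‖y‖ < r) {t : ℝ}
    (ht : localRep K x u y ≤ t) (ht' : t ≤ t₁) : x + (y : E) - t • u ∈ K := by
  have h1 : x + (y : E) - t₁ • u ∈ K := by
    simpa using h.ball_subset y hy 0 (by simpa using h.r_pos)
  have hpre : Convex ℝ {s : ℝ | x + (y : E) - s • u ∈ K} := by
    intro a ha b hb α β hα hβ hab
    have := hconv ha hb hα hβ hab
    simp only [mem_ofPred_eq]
    convert this using 1
    have hb' : β = 1 - α := by linarith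
    subst hb'
    simp only [smul_eq_mul]
    module
  exact hpre.ordConnected.out (h.isLeast y hy).1 h1 ⟨ht, ht'⟩

theorem mem_frontier (hcomp : IsCompact K) {y : (ℝ ∙ u)ᗮ} (hy : ‖y‖ < r) :
    x + (y : E) - localRep K x u y • u ∈ frontier K := by
  rw [hcomp.isClosed.frontier_eq]
  refine ⟨(h.isLeast y hy).1, fun hin => ?_⟩
  have hcont : Continuous fun s : ℝ => x + (y : E) - s • u := by fun_prop
  have hev := hcont.continuousAt.preimage_mem_nhds (isOpen_interior.mem_nhds hin)
  obtain ⟨ε, hε, hb⟩ := Metric.mem_nhds_iff.1 hev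
  have hmem : localRep K x u y - ε / 2 ∈ Metric.ball (localRep K x u y) ε := by
    rw [Metric.mem_ball, Real.dist_eq]
    rw [show localRep K x u y - ε / 2 - localRep K x u y = -(ε / 2) by ring, abs_neg,
      abs_of_pos (by linarith)]
    linarith
  have := (h.isLeast y hy).2 (interior_subset (s := K) (hb hmem))
  linarith

theorem localRep_zero (hxK : x ∈ K) : localRep K x u 0 = 0 := by
  have h0 : ‖(0 : (ℝ ∙ u)ᗮ)‖ < r := by simpa using h.r_pos
  exact le_antisymm ((h.isLeast 0 h0).2 (by simpa using hxK)) (h.nonneg 0 h0)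

end IsGraphOver

end BoundaryGraph

/-! ### Second-order expansion from a differentiable subgradient -/

section SecondOrder

variable {F : Type*} [NormedAddCommGroup F] [InnerProductSpace ℝ F]

/-- The inner product as a continuous bilinear map. -/
def innerCLM (F : Type*) [NormedAddCommGroup F] [InnerProductSpace ℝ F] : F →L[ℝ] F →L[ℝ] ℝ :=
  (isBoundedBilinearMap_inner (𝕜 := ℝ) (E := F)).toContinuousLinearMap

theorem innerCLM_apply (y z : F) : innerCLM F y z = inner ℝ y z := rfl

theorem norm_innerCLM_apply_le (y : F) : ‖innerCLM F y‖ ≤ ‖y‖ :=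
  ContinuousLinearMap.opNorm_le_bound _ (norm_nonneg _) fun z => norm_inner_le_norm y z

/-- The subgradient inequalities at `y` and at `z` squeeze the first-order error between `0` and `⟨g
z - g y, z - y⟩`, which is small by continuity of `g`. -/
theorem hasFDerivAt_of_subgradient {f : F → ℝ} {g : F → F} {U : Set F} (hU : IsOpen U)
    (hsub : ∀ y ∈ U, ∀ z ∈ U, inner ℝ (g y) (z - y) ≤ f z - f y) {y : F} (hy : y ∈ U)
    (hg : ContinuousAt g y) : HasFDerivAt f (innerCLM F (g y)) y := by
  rw [hasFDerivAt_iff_isLittleO, Asymptotics.isLittleO_iff]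
  intro c hc
  have h1 : ∀ᶠ z in 𝓝 y, ‖g z - g y‖ < c := by
    have := hg.eventually (Metric.ball_mem_nhds (g y) hc)
    simpa only [Metric.mem_ball, dist_eq_norm] using this
  filter_upwards [h1, hU.mem_nhds hy] with z hz hzU
  have h2 := hsub y hy z hzU
  have h3 := hsub z hzU y hy
  have h4 : inner ℝ (g z) (y - z) = - inner ℝ (g z) (z - y) := by
    rw [← neg_sub, inner_neg_right]
  rw [h4] at h3
  have h5 : inner ℝ (g z - g y) (z - y) ≤ c * ‖z - y‖ :=
    (real_inner_le_norm _ _).trans (by gcongr)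
  rw [inner_sub_left] at h5
  rw [innerCLM_apply, Real.norm_eq_abs, abs_of_nonneg (by linarith)]
  linarith

theorem isSymmetric_of_hasFDerivAt {f : F → ℝ} {g : F → F} {A : F →L[ℝ] F}
    (hf : ∀ᶠ y in 𝓝 0, HasFDerivAt f (innerCLM F (g y)) y) (hg : HasFDerivAt g A 0) :
    A.toLinearMap.IsSymmetric := by
  have h2 : HasFDerivAt (fun y => innerCLM F (g y)) ((innerCLM F) ∘L A) 0 :=
    (innerCLM F).hasFDerivAt.comp 0 hg
  intro v w
  have := second_derivative_symmetric_of_eventually_of_real hf h2 v w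
  simp only [ContinuousLinearMap.comp_apply, innerCLM_apply] at this
  rw [real_inner_comm w (A v)] at this
  simp only [ContinuousLinearMap.coe_coe]
  exact (real_inner_comm _ _).trans (this.trans (real_inner_comm _ _))

/-- The difference has gradient `g y - A y = o(‖y‖)`; the mean value inequality on the ball of
radius `‖y‖` gains one more power. -/
theorem isLittleO_sub_quadratic {f : F → ℝ} {g : F → F} {A : F →L[ℝ] F}
    (hf : ∀ᶠ y in 𝓝 0, HasFDerivAt f (innerCLM F (g y)) y) (hg : HasFDerivAt g A 0)
    (hf0 : f 0 = 0) (hg0 : g 0 = 0) :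
    (fun y => f y - (1 / 2) * inner ℝ (A y) y) =o[𝓝 0] (fun y : F => ‖y‖ ^ 2) := by
  have hsym := isSymmetric_of_hasFDerivAt hf hg
  have hquad : ∀ y, HasFDerivAt (fun y => (1 / 2 : ℝ) * inner ℝ (A y) y) (innerCLM F (A y)) y := by
    intro y
    have h1 := (A.hasFDerivAt (x := y)).inner ℝ (hasFDerivAt_id y)
    have h2 := h1.const_mul (1 / 2 : ℝ)
    refine h2.congr_fderiv ?_
    ext v
    have e : inner ℝ (A v) y = inner ℝ (A y) v := by
      have := hsym v y
      simp only [ContinuousLinearMap.coe_coe] at this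
      rw [this, real_inner_comm]
    simp [innerCLM_apply, fderivInnerCLM_apply, e]
    ring
  rw [Asymptotics.isLittleO_iff]
  intro c hc
  have hgo := (hasFDerivAt_iff_isLittleO.1 hg).def hc
  obtain ⟨ε, hε, hball⟩ := Metric.mem_nhds_iff.1 (hgo.and hf)
  filter_upwards [Metric.ball_mem_nhds (0 : F) hε] with y hy
  have hsubset : Metric.closedBall (0 : F) ‖y‖ ⊆ Metric.ball 0 ε := by
    apply Metric.closedBall_subset_ball
    simpa using hy
  have hmvt := Convex.norm_image_sub_le_of_norm_hasFDerivWithin_le (𝕜 := ℝ)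
    (f := fun y => f y - (1 / 2) * inner ℝ (A y) y)
    (f' := fun y => innerCLM F (g y) - innerCLM F (A y)) (C := c * ‖y‖)
    (s := Metric.closedBall (0 : F) ‖y‖) (x := 0) (y := y)
    (fun z hz => ((hball (hsubset hz)).2.sub (hquad z)).hasFDerivWithinAt)
    (fun z hz => by
      rw [← map_sub]
      refine (norm_innerCLM_apply_le _).trans ?_
      have h1 := (hball (hsubset hz)).1
      simp only [hg0, sub_zero] at h1
      refine h1.trans ?_
      have : ‖z‖ ≤ ‖y‖ := by simpa using hz
      gcongr)
    (convex_closedBall 0 ‖y‖) (by simp) (by simp)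
  simp only [hf0, map_zero, inner_zero_left, mul_zero, sub_zero] at hmvt
  rw [norm_pow, norm_norm, sq, ← mul_assoc]
  exact hmvt

/-- A direction of negative curvature would make `f` negative at small multiples of it. -/
theorem quadratic_nonneg_of_isLittleO {f : F → ℝ} {A : F →ₗ[ℝ] F}
    (ho : (fun y => f y - (1 / 2) * inner ℝ (A y) y) =o[𝓝 0] (fun y : F => ‖y‖ ^ 2))
    (hf : ∀ᶠ y in 𝓝 0, 0 ≤ f y) (y : F) : 0 ≤ inner ℝ (A y) y := by
  by_contra! hneg
  have hy : y ≠ 0 := by rintro rfl; simp at hneg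
  have hny : 0 < ‖y‖ ^ 2 := by positivity
  have hc : 0 < -inner ℝ (A y) y / (4 * ‖y‖ ^ 2) := by
    apply div_pos <;> linarith
  have ht : Tendsto (fun t : ℝ => t • y) (𝓝[>] 0) (𝓝 0) := by
    have : Tendsto (fun t : ℝ => t • y) (𝓝 0) (𝓝 ((0 : ℝ) • y)) :=
      (continuous_id.smul continuous_const).tendsto 0
    rw [zero_smul] at this
    exact this.mono_left nhdsWithin_le_nhds
  obtain ⟨t, ⟨h1, h2⟩, ht0⟩ :=
    ((ht.eventually ((ho.def hc).and hf)).and self_mem_nhdsWithin).exists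
  have ht0' : (0 : ℝ) < t := ht0
  have h3 := (le_abs_self _).trans h1
  rw [map_smul, inner_smul_left, inner_smul_right, norm_pow, norm_norm, norm_smul,
    Real.norm_of_nonneg ht0'.le, mul_pow] at h3
  simp only [conj_trivial] at h3
  have e : -inner ℝ (A y) y / (4 * ‖y‖ ^ 2) * (t ^ 2 * ‖y‖ ^ 2) =
      t ^ 2 * (-inner ℝ (A y) y) / 4 := by field_simp
  rw [e] at h3
  have := mul_pos (pow_pos ht0' 2) (neg_pos.2 hneg)
  nlinarith

end SecondOrder

/-! ### The local Hessian as the derivative of the Gauss map -/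

section LocalHessian

variable {E : Type*} [NormedAddCommGroup E] [InnerProductSpace ℝ E]
  {K : Set E} {x u : E} {r t₁ : ℝ}

/-- The body contains a ball about the point at depth `t₁` below. A supporting hyperplane at the
graph must leave the whole ball on one side, so its normal cannot become orthogonal to `u`. -/
theorem IsGraphOver.le_inner_normal (h : IsGraphOver K x u r t₁) {y : (ℝ ∙ u)ᗮ} (hy : ‖y‖ < r)
    {ν : E} (hν : IsOuterUnitNormal K (x + (y : E) - localRep K x u y • u) ν) :
    r / 2 / t₁ ≤ inner ℝ ν u := by
  have hr := h.r_pos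
  have h1 := hν.2 _ (h.ball_subset y hy ((r / 2) • ν) (by
    rw [norm_smul, hν.1, Real.norm_of_nonneg (by linarith)]; linarith))
  have h2 := h.nonneg y hy
  have h3 := h.localRep_le hy
  rw [inner_add_right, inner_sub_right, inner_sub_right, inner_smul_right, inner_smul_right,
    inner_smul_right, real_inner_self_eq_norm_sq, hν.1] at h1
  have h4 : r / 2 ≤ (t₁ - localRep K x u y) * inner ℝ ν u := by linarith
  have h5 : 0 < inner ℝ ν u := by
    by_contra! hneg
    have := mul_nonneg (sub_nonneg.2 h3) (neg_nonneg.2 hneg)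
    linarith
  rw [div_le_iff₀ h.t_pos, mul_comm]
  nlinarith

/-- If the Gauss map of a convex body extends to a continuous map which is differentiable at a
boundary point `x`, then the local representation of the boundary at `x` is twice differentiable
at the origin, and its Hessian is the tangential part of the derivative of the Gauss map. -/
theorem IsGraphOver.hasLocalHessian [CompleteSpace E] (h : IsGraphOver K x u r t₁) (hcomp : IsCompact K)
    (hxK : x ∈ K) (hu : ‖u‖ = 1) {N : E → E} (hN : Continuous N)
    (hNn : ∀ p ∈ frontier K, IsOuterUnitNormal K p (N p)) (hNx : N x = u)
    {D : E →L[ℝ] E} (hD : HasFDerivAt N D x) :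
    HasLocalHessian K x u
      ((ℝ ∙ u)ᗮ.orthogonalProjectionOnto ∘L D ∘L (ℝ ∙ u)ᗮ.subtypeL).toLinearMap := by
  set f := localRep K x u with hf
  set P := (ℝ ∙ u)ᗮ.orthogonalProjectionOnto with hP
  let p : (ℝ ∙ u)ᗮ → E := fun y => x + (y : E) - f y • u
  let β : (ℝ ∙ u)ᗮ → ℝ := fun y => inner ℝ (N (p y)) u
  let g : (ℝ ∙ u)ᗮ → (ℝ ∙ u)ᗮ := fun y => (β y)⁻¹ • P (N (p y))
  set U : Set (ℝ ∙ u)ᗮ := Metric.ball 0 r with hU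
  have hUo : IsOpen U := Metric.isOpen_ball
  have hmemU : ∀ y, y ∈ U ↔ ‖y‖ < r := fun y => by simp [hU]
  have hr := h.r_pos
  have ht := h.t_pos
  have h0U : (0 : (ℝ ∙ u)ᗮ) ∈ U := by rw [hmemU]; simpa using hr
  have hnorm : ∀ y ∈ U, IsOuterUnitNormal K (p y) (N (p y)) := fun y hy =>
    hNn _ (h.mem_frontier hcomp ((hmemU y).1 hy))
  set b := r / 2 / t₁ with hb
  have hb0 : 0 < b := by positivity
  have hβ : ∀ y ∈ U, b ≤ β y := fun y hy => h.le_inner_normal ((hmemU y).1 hy) (hnorm y hy)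
  -- Dividing the tangential part of the normal by its component along `u` gives the slope of the
  -- supporting hyperplane, that is, a subgradient of `f`.
  have hsub : ∀ y ∈ U, ∀ z ∈ U, inner ℝ (g y) (z - y) ≤ f z - f y := by
    intro y hy z hz
    have h1 := (hnorm y hy).2 (p z) (h.isLeast z ((hmemU z).1 hz)).1
    have hβ0 : 0 < β y := hb0.trans_le (hβ y hy)
    have h2 : inner ℝ (N (p y)) (p z - p y) =
        inner ℝ (P (N (p y))) (z - y) - (f z - f y) * β y := by
      have e : p z - p y = ((z - y : (ℝ ∙ u)ᗮ) : E) - (f z - f y) • u := by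
        simp only [p, Submodule.coe_sub]; module
      rw [e, inner_sub_right, inner_smul_right, Submodule.inner_orthogonalProjectionOnto_eq_of_mem_right]
    have h3 : inner ℝ (N (p y)) (p z - p y) ≤ 0 := by
      rw [inner_sub_right]; linarith
    rw [h2] at h3
    simp only [g, inner_smul_left, conj_trivial]
    rw [inv_mul_le_iff₀ hβ0]
    linarith
  have hgb : ∀ y ∈ U, ‖g y‖ ≤ b⁻¹ := by
    intro y hy
    have hβ0 : 0 < β y := hb0.trans_le (hβ y hy)
    have h1 : ‖P (N (p y))‖ ≤ 1 := by
      rw [← (hnorm y hy).1]; exact Submodule.norm_orthogonalProjectionOnto_apply_le _ _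
    simp only [g]
    rw [norm_smul, norm_inv, Real.norm_of_nonneg hβ0.le]
    calc (β y)⁻¹ * ‖P (N (p y))‖ ≤ b⁻¹ * 1 := by
          gcongr; exact hβ y hy
      _ = b⁻¹ := mul_one _
  -- Bounded subgradients make `f` Lipschitz; then `p`, and with it `g`, is continuous, so `g` is
  -- the true gradient of `f`.
  have hfcont : ContinuousOn f U := by
    have hlip : LipschitzOnWith (b⁻¹).toNNReal f U := by
      apply LipschitzOnWith.of_le_add_mul
      intro y hy z hz
      have h1 := hsub y hy z hz
      have h2 : -(inner ℝ (g y) (z - y)) ≤ b⁻¹ * dist y z := by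
        rw [dist_comm, dist_eq_norm]
        refine (neg_le_abs _).trans ((abs_real_inner_le_norm _ _).trans ?_)
        gcongr
        exact hgb y hy
      rw [Real.coe_toNNReal _ (inv_nonneg.2 hb0.le)]
      linarith
    exact hlip.continuousOn
  have hNp : ∀ y ∈ U, ContinuousAt (fun y => N (p y)) y := fun y hy => by
    have hfy : ContinuousAt f y := hfcont.continuousAt (hUo.mem_nhds hy)
    have : ContinuousAt p y := by
      have h1 : ContinuousAt (fun y : (ℝ ∙ u)ᗮ => x + (y : E)) y := by fun_prop
      exact h1.sub (hfy.smul continuousAt_const)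
    exact hN.continuousAt.comp this
  have hgc : ∀ y ∈ U, ContinuousAt g y := fun y hy => by
    have h1 := hNp y hy
    have h2 : ContinuousAt β y := h1.inner continuousAt_const
    exact (h2.inv₀ (hb0.trans_le (hβ y hy)).ne').smul (P.continuous.continuousAt.comp h1)
  have hfd : ∀ᶠ y in 𝓝 0, HasFDerivAt f (innerCLM _ (g y)) y := by
    filter_upwards [hUo.mem_nhds h0U] with y hy
    exact hasFDerivAt_of_subgradient hUo hsub hy (hgc y hy)
  have hf0 : f 0 = 0 := h.localRep_zero hxK
  have hp0 : p 0 = x := by simp [p, hf0]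
  have hPu : P u = 0 := Submodule.orthogonalProjectionOnto_orthogonalComplement_singleton_eq_zero u
  have hβ0 : β 0 = 1 := by
    simp only [β, hp0, hNx, real_inner_self_eq_norm_sq, hu]; norm_num
  have hg0 : g 0 = 0 := by simp [g, hp0, hNx, hPu]
  have hpd : HasFDerivAt p (ℝ ∙ u)ᗮ.subtypeL 0 := by
    have h1 : HasFDerivAt f (0 : (ℝ ∙ u)ᗮ →L[ℝ] ℝ) 0 := by
      have := hfd.self_of_nhds
      rwa [hg0, map_zero] at this
    have h2 : HasFDerivAt (fun y : (ℝ ∙ u)ᗮ => x + (y : E)) (ℝ ∙ u)ᗮ.subtypeL 0 :=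
      ((ℝ ∙ u)ᗮ.subtypeL.hasFDerivAt).const_add x
    refine (h2.sub (h1.smul_const u)).congr_fderiv ?_
    ext v; simp
  have hNd : HasFDerivAt (fun y => N (p y)) (D ∘L (ℝ ∙ u)ᗮ.subtypeL) 0 := by
    have hD' : HasFDerivAt N D (p 0) := by rwa [hp0]
    exact hD'.comp 0 hpd
  have hgd : HasFDerivAt g (P ∘L D ∘L (ℝ ∙ u)ᗮ.subtypeL) 0 := by
    have h1 : HasFDerivAt (fun y => P (N (p y))) (P ∘L D ∘L (ℝ ∙ u)ᗮ.subtypeL) 0 :=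
      P.hasFDerivAt.comp 0 hNd
    have h2 : DifferentiableAt ℝ (fun y => (β y)⁻¹) 0 := by
      have : DifferentiableAt ℝ β 0 := hNd.differentiableAt.inner ℝ (differentiableAt_const u)
      exact this.inv (by rw [hβ0]; exact one_ne_zero)
    -- The derivative of `β⁻¹` does not contribute, since it is multiplied by `P (N x) = P u = 0`.
    refine (h2.hasFDerivAt.smul h1).congr_fderiv ?_
    ext v; simp [hβ0, hp0, hNx, hPu]
  exact ⟨isSymmetric_of_hasFDerivAt hfd hgd, isLittleO_sub_quadratic hfd hgd hf0 hg0⟩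

end LocalHessian

/-! ### Square root of the Hessian -/

section Diagonalization

/-- A positive definite operator is `Sᵀ S` for a diagonal operator `S` in suitable orthonormal
coordinates. -/
theorem exists_isometryEquiv_norm_sq_eq {F : Type*} [NormedAddCommGroup F]
    [InnerProductSpace ℝ F] [FiniteDimensional ℝ F] {m : ℕ} (hm : Module.finrank ℝ F = m)
    {A : F →ₗ[ℝ] F} (hA : A.IsSymmetric) (hnonneg : ∀ y, 0 ≤ inner ℝ (A y) y)
    (hinj : ∀ y, A y = 0 → y = 0) :
    ∃ (e : EuclideanSpace ℝ (Fin m) ≃ₗᵢ[ℝ] F)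
      (S : EuclideanSpace ℝ (Fin m) →ₗ[ℝ] EuclideanSpace ℝ (Fin m)),
      (∀ y, ‖S y‖ ^ 2 = inner ℝ (A (e y)) (e y)) ∧ 0 < LinearMap.det S ∧
        LinearMap.det S ^ 2 = LinearMap.det A := by
  set b := hA.eigenvectorBasis hm
  set l := hA.eigenvalues hm
  have hAb : ∀ i, A (b i) = l i • b i := fun i => hA.apply_eigenvectorBasis hm i
  have hb : ∀ i, ‖b i‖ = 1 := fun i => b.orthonormal.1 i
  have hl : ∀ i, 0 < l i := by
    intro i
    have h1 := hnonneg (b i)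
    rw [hAb, inner_smul_left, real_inner_self_eq_norm_sq, hb] at h1
    have h2 : l i ≠ 0 := by
      intro h0
      have h3 := hinj (b i) (by rw [hAb, h0, zero_smul])
      have h4 := hb i
      rw [h3, norm_zero] at h4
      exact zero_ne_one h4
    have h1' : 0 ≤ l i := by simpa using h1
    exact lt_of_le_of_ne h1' h2.symm
  have hcoord : ∀ (y : EuclideanSpace ℝ (Fin m)) (i : Fin m),
      b.repr (A (b.repr.symm y)) i = l i * y i := fun y i => by
    refine (hA.eigenvectorBasis_apply_self_apply hm (b.repr.symm y) i).trans ?_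
    rw [LinearIsometryEquiv.apply_symm_apply]
    rfl
  refine ⟨b.repr.symm, Matrix.toLpLin 2 2 (Matrix.diagonal fun i => √(l i)), ?_, ?_, ?_⟩
  · intro y
    rw [← b.repr.inner_map_map, EuclideanSpace.norm_sq_eq, PiLp.inner_apply]
    refine Finset.sum_congr rfl fun i _ => ?_
    rw [hcoord]
    simp only [Matrix.toLpLin_apply, Matrix.mulVec_diagonal, LinearIsometryEquiv.apply_symm_apply,
      Real.norm_eq_abs, sq_abs, mul_pow, Real.sq_sqrt (hl i).le]
    simp
    ring
  · rw [Matrix.toLpLin_eq_toLin, LinearMap.det_toLin, Matrix.det_diagonal]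
    exact Finset.prod_pos fun i _ => Real.sqrt_pos.2 (hl i)
  · rw [Matrix.toLpLin_eq_toLin, LinearMap.det_toLin, Matrix.det_diagonal,
      hA.det_eq_prod_eigenvalues hm, ← Finset.prod_pow]
    refine Finset.prod_congr rfl fun i _ => ?_
    rw [Real.sq_sqrt (hl i).le]
    rfl

end Diagonalization

/-! ### Unique support points and differentiability of the support function -/

section SupportPoint

variable {E : Type*} [NormedAddCommGroup E] [InnerProductSpace ℝ E] {K : Set E} {x u : E}

theorem sub_mem_orthogonal_of_inner_eq {k : E}
    (hk : inner ℝ u k = inner ℝ u x) : k - x ∈ (ℝ ∙ u)ᗮ := by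
  rw [Submodule.mem_orthogonal_singleton_iff_inner_right, inner_sub_right, hk, sub_self]

/-- A boundary point with a positive definite local Hessian is the only point of its face. -/
theorem eq_of_inner_eq {r t₁ : ℝ} (h : IsGraphOver K x u r t₁) (hconv : Convex ℝ K) (hxK : x ∈ K)
    {A : (ℝ ∙ u)ᗮ →ₗ[ℝ] (ℝ ∙ u)ᗮ} (hA : HasLocalHessian K x u A)
    (hpos : ∀ y, y ≠ 0 → 0 < inner ℝ (A y) y) {k : E} (hk : k ∈ K)
    (hku : inner ℝ u k = inner ℝ u x) : k = x := by
  by_contra hne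
  set y : (ℝ ∙ u)ᗮ := ⟨k - x, sub_mem_orthogonal_of_inner_eq hku⟩ with hy
  have hy0 : y ≠ 0 := by
    intro h0
    exact hne (sub_eq_zero.1 (congrArg Subtype.val h0))
  have hny : 0 < ‖y‖ ^ 2 := by positivity
  have hp := hpos y hy0
  have hc : 0 < inner ℝ (A y) y / (4 * ‖y‖ ^ 2) := by positivity
  have ht : Tendsto (fun t : ℝ => t • y) (𝓝[>] 0) (𝓝 0) := by
    have : Tendsto (fun t : ℝ => t • y) (𝓝 0) (𝓝 ((0 : ℝ) • y)) :=
      (continuous_id.smul continuous_const).tendsto 0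
    rw [zero_smul] at this
    exact this.mono_left nhdsWithin_le_nhds
  obtain ⟨t, ⟨⟨h1, h2⟩, ht1⟩, ht0⟩ := (((ht.eventually ((hA.2.def hc).and
    (Metric.ball_mem_nhds 0 h.r_pos))).and
      (nhdsWithin_le_nhds (Iio_mem_nhds one_pos))).and self_mem_nhdsWithin).exists
  have ht0 : (0 : ℝ) < t := ht0
  have ht1 : t < 1 := ht1
  have h2 : ‖t • y‖ < r := by simpa using h2
  -- The segment from `x` to `k` lies in the tangent hyperplane, so the graph function vanishes
  -- along it, which the positive quadratic term forbids.
  have hmem : x + ((t • y : (ℝ ∙ u)ᗮ) : E) - (0 : ℝ) • u ∈ K := by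
    have := hconv hxK hk (sub_nonneg.2 ht1.le) ht0.le (by ring)
    convert this using 1
    simp only [Submodule.coe_smul, hy]
    module
  have hf0 : localRep K x u (t • y) = 0 :=
    le_antisymm ((h.isLeast _ h2).2 hmem) (h.nonneg _ h2)
  rw [hf0, map_smul, inner_smul_left, inner_smul_right, zero_sub, norm_neg, norm_pow, norm_norm,
    norm_smul, Real.norm_of_nonneg ht0.le, mul_pow, conj_trivial,
    Real.norm_of_nonneg (by positivity)] at h1
  have e : inner ℝ (A y) y / (4 * ‖y‖ ^ 2) * (t ^ 2 * ‖y‖ ^ 2) = t ^ 2 * inner ℝ (A y) y / 4 := by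
    field_simp
  rw [e] at h1
  have := mul_pos (pow_pos ht0 2) hp
  nlinarith

/-- The caps of `K` at a unique support point shrink to this point. -/
theorem exists_cap_subset_ball (hcomp : IsCompact K) (hx : IsOuterUnitNormal K x u)
    (huniq : ∀ k ∈ K, inner ℝ u k = inner ℝ u x → k = x) {ε : ℝ} (hε : 0 < ε) :
    ∃ s > 0, ∀ k ∈ K, inner ℝ u x - s ≤ inner ℝ u k → ‖k - x‖ < ε := by
  have hc : IsCompact (K \ Metric.ball x ε) := hcomp.diff Metric.isOpen_ball
  rcases (K \ Metric.ball x ε).eq_empty_or_nonempty with h | h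
  · refine ⟨1, one_pos, fun k hk _ => ?_⟩
    by_contra hlt
    have : k ∈ K \ Metric.ball x ε := ⟨hk, by rwa [Metric.mem_ball, dist_eq_norm]⟩
    rw [h] at this
    exact this
  · obtain ⟨k₀, hk₀, hmax⟩ := hc.exists_isMaxOn h
      (f := fun k => inner ℝ u k) (by fun_prop)
    have hlt : inner ℝ u k₀ < inner ℝ u x := by
      refine lt_of_le_of_ne (hx.2 _ hk₀.1) fun heq => ?_
      have := huniq _ hk₀.1 heq
      subst this
      exact hk₀.2 (Metric.mem_ball_self hε)
    refine ⟨(inner ℝ u x - inner ℝ u k₀) / 2, by linarith, fun k hk hks => ?_⟩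
    by_contra hn
    have : inner ℝ u k ≤ inner ℝ u k₀ :=
      hmax ⟨hk, by rwa [Metric.mem_ball, dist_eq_norm]⟩
    linarith

theorem IsOuterUnitNormal.supportFn_eq (hx : IsOuterUnitNormal K x u) (hxK : x ∈ K) :
    supportFn K u = inner ℝ u x := by
  apply IsGreatest.csSup_eq
  refine ⟨⟨x, hxK, rfl⟩, ?_⟩
  rintro _ ⟨k, hk, rfl⟩
  exact hx.2 k hk

/-- The support function is differentiable at the outer normal of a unique support point. -/
theorem hasGradientAt_supportFn [CompleteSpace E] (hcomp : IsCompact K) (hxK : x ∈ K)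
    (hx : IsOuterUnitNormal K x u) (huniq : ∀ k ∈ K, inner ℝ u k = inner ℝ u x → k = x) :
    HasGradientAt (supportFn K) x u := by
  rw [hasGradientAt_iff_isLittleO, Asymptotics.isLittleO_iff]
  intro c hc
  obtain ⟨s, hs, hcap⟩ := exists_cap_subset_ball hcomp hx huniq hc
  obtain ⟨R, hR, hKR⟩ := hcomp.isBounded.subset_closedBall_lt 0 x
  -- For such `v` a maximiser `k` of `⟨v, ·⟩` loses at most `‖v - u‖ ‖k - x‖ ≤ s` in direction `u`.
  -- It therefore lies in the cap of depth `s`, within `c` of `x`.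
  have hnear : ∀ᶠ v in 𝓝 u, ‖v - u‖ < s / R := by
    have := Metric.ball_mem_nhds u (div_pos hs hR)
    filter_upwards [this] with v hv
    rwa [Metric.mem_ball, dist_eq_norm] at hv
  filter_upwards [hnear] with v hv
  obtain ⟨k, hk, hkv⟩ := hcomp.exists_isMaxOn ⟨x, hxK⟩ (f := fun k => inner ℝ v k) (by fun_prop)
  have hkv' : supportFn K v = inner ℝ v k := by
    apply IsGreatest.csSup_eq
    refine ⟨⟨k, hk, rfl⟩, ?_⟩
    rintro _ ⟨z, hz, rfl⟩
    exact hkv hz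
  have hvx : inner ℝ v x ≤ inner ℝ v k := hkv hxK
  have hux : inner ℝ u k ≤ inner ℝ u x := hx.2 k hk
  have hkx : ‖k - x‖ ≤ R := by
    have := hKR hk
    rwa [Metric.mem_closedBall, dist_eq_norm] at this
  have h1 : inner ℝ (v - u) (k - x) ≤ ‖v - u‖ * ‖k - x‖ := real_inner_le_norm _ _
  have h2 : inner ℝ (v - u) (k - x) =
      inner ℝ v k - inner ℝ v x - (inner ℝ u k - inner ℝ u x) := by
    rw [inner_sub_left, inner_sub_right, inner_sub_right]
  have h3 : ‖v - u‖ * ‖k - x‖ ≤ s := by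
    calc ‖v - u‖ * ‖k - x‖ ≤ s / R * R := by gcongr
      _ = s := div_mul_cancel₀ _ hR.ne'
  have h4 : ‖k - x‖ < c := hcap k hk (by linarith)
  rw [hkv', hx.supportFn_eq hxK, inner_sub_right, real_inner_comm v x, real_inner_comm u x,
    Real.norm_eq_abs, abs_of_nonneg (by linarith)]
  have h5 : ‖v - u‖ * ‖k - x‖ ≤ c * ‖v - u‖ := by
    rw [mul_comm]; gcongr
  linarith

end SupportPoint

/-! ### Asymptotic weighted volumes of caps -/

section CapVolume

theorem weightedVolume_mono {E : Type*} [NormedAddCommGroup E] [InnerProductSpace ℝ E]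
    [MeasureSpace E] (φ : E → ℝ) {S T : Set E} (h : S ⊆ T) :
    weightedVolume φ S ≤ weightedVolume φ T :=
  lintegral_mono_set h

theorem weightedVolume_le_of_forall_le {E : Type*} [NormedAddCommGroup E] [InnerProductSpace ℝ E]
    [MeasureSpace E] {φ : E → ℝ} {S : Set E} (hS : MeasurableSet S) {c : ℝ}
    (h : ∀ x ∈ S, φ x ≤ c) : weightedVolume φ S ≤ ENNReal.ofReal c * volume S := by
  rw [← setLIntegral_const]
  exact setLIntegral_mono' hS fun x hx => ENNReal.ofReal_le_ofReal (h x hx)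

theorem le_weightedVolume_of_forall_le {E : Type*} [NormedAddCommGroup E] [InnerProductSpace ℝ E]
    [MeasureSpace E] {φ : E → ℝ} {S : Set E} (hS : MeasurableSet S) {c : ℝ}
    (h : ∀ x ∈ S, c ≤ φ x) : ENNReal.ofReal c * volume S ≤ weightedVolume φ S := by
  rw [← setLIntegral_const]
  exact setLIntegral_mono' hS fun x hx => ENNReal.ofReal_le_ofReal (h x hx)

theorem isClosed_halfSpaceGE {E : Type*} [NormedAddCommGroup E] [InnerProductSpace ℝ E]
    (u : E) (t : ℝ) : IsClosed (halfSpaceGE u t) :=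
  isClosed_le continuous_const (by fun_prop)

variable {m : ℕ} {K : Set (EuclideanSpace ℝ (Fin (m + 1)))}
  {x u : EuclideanSpace ℝ (Fin (m + 1))} (e : EuclideanSpace ℝ (Fin m) ≃ₗᵢ[ℝ] (ℝ ∙ u)ᗮ)
  {S : EuclideanSpace ℝ (Fin m) →ₗ[ℝ] EuclideanSpace ℝ (Fin m)}
  {A : (ℝ ∙ u)ᗮ →ₗ[ℝ] (ℝ ∙ u)ᗮ}

theorem measurePreserving_add_hyperplaneChart (x : EuclideanSpace ℝ (Fin (m + 1)))
    (hu : ‖u‖ = 1) : MeasurePreserving (fun p => x + hyperplaneChart e p) :=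
  (measurePreserving_add_left volume x).comp (measurePreserving_hyperplaneChart e hu)

theorem exists_norm_le_mul (hS : LinearMap.det S ≠ 0) : ∃ c : ℝ, 0 < c ∧ ∀ y, ‖y‖ ≤ c * ‖S y‖ := by
  have hker : LinearMap.ker S = ⊥ := by
    by_contra h
    exact hS (LinearMap.det_eq_zero_iff_ker_ne_bot.2 h)
  obtain ⟨C, hC, hanti⟩ := S.exists_antilipschitzWith hker
  refine ⟨C, hC, fun y => ?_⟩
  have := hanti.le_mul_dist y 0
  simpa using this

/-- Near the origin, the local representation is pinched between two multiples of the quadratic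
form of its Hessian. -/
theorem exists_localRep_pinched (hA : HasLocalHessian K x u A) (hS : LinearMap.det S ≠ 0)
    (hSA : ∀ y, ‖S y‖ ^ 2 = inner ℝ (A (e y)) (e y)) {ε : ℝ} (hε : 0 < ε) :
    ∃ η > 0, ∀ y, ‖y‖ < η → (1 - ε) * (1 / 2 * ‖S y‖ ^ 2) ≤ localRep K x u (e y) ∧
      localRep K x u (e y) ≤ (1 + ε) * (1 / 2 * ‖S y‖ ^ 2) := by
  obtain ⟨c, hc, hcS⟩ := exists_norm_le_mul hS
  have hε' : 0 < ε / (2 * c ^ 2) := by positivity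
  obtain ⟨η, hη, hball⟩ := Metric.mem_nhds_iff.1 (hA.2.def hε')
  refine ⟨η, hη, fun y hy => ?_⟩
  have hy' : e y ∈ Metric.ball 0 η := by simpa using hy
  have h1 : |localRep K x u (e y) - 1 / 2 * inner ℝ (A (e y)) (e y)| ≤
      ε / (2 * c ^ 2) * ‖‖e y‖ ^ 2‖ := hball hy'
  rw [← hSA, norm_pow, norm_norm, e.norm_map] at h1
  have h2 : ‖y‖ ^ 2 ≤ c ^ 2 * ‖S y‖ ^ 2 := by
    rw [← mul_pow]; exact pow_le_pow_left₀ (norm_nonneg _) (hcS y) 2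
  have h3 : ε / (2 * c ^ 2) * ‖y‖ ^ 2 ≤ ε * (1 / 2 * ‖S y‖ ^ 2) := by
    calc ε / (2 * c ^ 2) * ‖y‖ ^ 2 ≤ ε / (2 * c ^ 2) * (c ^ 2 * ‖S y‖ ^ 2) := by gcongr
      _ = _ := by field_simp
  have h4 := abs_le.1 (h1.trans h3)
  constructor <;> linarith [h4.1, h4.2]

theorem det_sqrt_smul (c : ℝ) : LinearMap.det (√c • S) = √c ^ m * LinearMap.det S := by
  simp [LinearMap.det_smul]

theorem norm_sqrt_smul_sq {c : ℝ} (hc : 0 ≤ c) (y : EuclideanSpace ℝ (Fin m)) :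
    ‖(√c • S) y‖ ^ 2 = c * ‖S y‖ ^ 2 := by
  rw [LinearMap.smul_apply, norm_smul, Real.norm_of_nonneg (Real.sqrt_nonneg _), mul_pow,
    Real.sq_sqrt hc]

variable {φ : EuclideanSpace ℝ (Fin (m + 1)) → ℝ} [NeZero m]

/-- Asymptotic upper bound for the weighted volume of the caps in the normal direction. -/
theorem weightedVolume_cap_le (hcomp : IsCompact K) (hφ : ContinuousOn φ K) (hxK : x ∈ K)
    (hφx : 0 < φ x) (hx : IsOuterUnitNormal K x u)
    (huniq : ∀ k ∈ K, inner ℝ u k = inner ℝ u x → k = x) {r t₁ : ℝ} (h : IsGraphOver K x u r t₁)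
    (hA : HasLocalHessian K x u A) (hS : 0 < LinearMap.det S)
    (hSA : ∀ y, ‖S y‖ ^ 2 = inner ℝ (A (e y)) (e y)) {c : ℝ}
    (hc : φ x * capConst (m + 1) / LinearMap.det S < c) :
    ∀ᶠ s : ℝ in 𝓝[>] 0, weightedVolume φ (K ∩ halfSpaceGE u (inner ℝ u x - s)) ≤
      ENNReal.ofReal (c * s ^ (((m : ℝ) + 2) / 2)) := by
  -- Near `x` the density is at most `φ x + ε` and the boundary lies above the paraboloid of `√(1 -
  -- ε) • S`; `ε` is chosen so that the resulting constant is still below `c`.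
  have hlim : Tendsto (fun ε : ℝ => (φ x + ε) * (capConst (m + 1) /
      (√(1 - ε) ^ m * LinearMap.det S))) (𝓝[>] 0)
      (𝓝 (φ x * capConst (m + 1) / LinearMap.det S)) := by
    have : ContinuousAt (fun ε : ℝ => (φ x + ε) * (capConst (m + 1) /
      (√(1 - ε) ^ m * LinearMap.det S))) 0 := by
      apply ContinuousAt.mul (by fun_prop)
      apply ContinuousAt.div continuousAt_const (by fun_prop)
      simpa using hS.ne'
    have h2 := this.tendsto
    simp only [add_zero, sub_zero, Real.sqrt_one, one_pow, one_mul, ← mul_div_assoc] at h2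
    simp only [← mul_div_assoc]
    exact h2.mono_left nhdsWithin_le_nhds
  obtain ⟨ε, ⟨hε1, hε2⟩, hε0⟩ := ((hlim.eventually (gt_mem_nhds hc)).and
    (nhdsWithin_le_nhds (Iio_mem_nhds one_pos))).and self_mem_nhdsWithin |>.exists
  have hε0 : (0 : ℝ) < ε := hε0
  have hε2 : ε < 1 := hε2
  obtain ⟨η, hη, hpinch⟩ := exists_localRep_pinched e hA hS.ne' hSA hε0
  obtain ⟨ρ, hρ, hφρ⟩ : ∃ ρ > 0, ∀ k ∈ K, ‖k - x‖ < ρ → φ k ≤ φ x + ε := by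
    obtain ⟨ρ, hρ, hh⟩ := Metric.continuousOn_iff.1 hφ x hxK ε hε0
    refine ⟨ρ, hρ, fun k hk hkρ => ?_⟩
    have := hh k hk (by rwa [dist_eq_norm])
    rw [Real.dist_eq] at this
    linarith [(abs_lt.1 this).2]
  obtain ⟨s₀, hs₀, hcap⟩ := exists_cap_subset_ball hcomp hx huniq
    (lt_min (lt_min hη hρ) h.r_pos)
  have hdet : 0 < LinearMap.det (√(1 - ε) • S) := by
    have : 0 < √(1 - ε) := Real.sqrt_pos.2 (by linarith)
    rw [det_sqrt_smul]; positivity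
  filter_upwards [self_mem_nhdsWithin, nhdsWithin_le_nhds (Iio_mem_nhds hs₀)] with s hs hss₀
  have hs : (0 : ℝ) < s := hs
  have hss₀ : s < s₀ := hss₀
  set T := K ∩ halfSpaceGE u (inner ℝ u x - s) with hT
  have hTm : MeasurableSet T := (hcomp.isClosed.inter (isClosed_halfSpaceGE _ _)).measurableSet
  have hnear : ∀ k ∈ T, ‖k - x‖ < min (min η ρ) r := fun k hk =>
    hcap k hk.1 (by have : inner ℝ u x - s ≤ inner ℝ u k := hk.2
                    linarith)
  have hvol : volume T ≤ volume (ellipticCap (√(1 - ε) • S) s) := by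
    rw [← (measurePreserving_add_hyperplaneChart e x hx.1).measure_preimage hTm.nullMeasurableSet]
    apply measure_mono
    rintro ⟨y, t⟩ hyt
    have hk := hnear _ hyt
    rw [add_sub_cancel_left] at hk
    have hyn : ‖y‖ < min (min η ρ) r := by
      refine lt_of_le_of_lt ?_ hk
      apply le_of_sq_le_sq _ (norm_nonneg _)
      rw [norm_hyperplaneChart_sq e hx.1]
      nlinarith [sq_nonneg t]
    have hmemK : x + hyperplaneChart e (y, t) ∈ K := hyt.1
    rw [hyperplaneChart_apply, ← add_sub_assoc] at hmemK
    have hft : localRep K x u (e y) ≤ t :=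
      (h.isLeast (e y) (by rw [e.norm_map]; exact hyn.trans_le (min_le_right _ _))).2 hmemK
    have hp := (hpinch y (hyn.trans_le ((min_le_left _ _).trans (min_le_left _ _)))).1
    have hts : t ≤ s := by
      have : inner ℝ u x - s ≤ inner ℝ u (x + hyperplaneChart e (y, t)) := hyt.2
      rw [hyperplaneChart_apply, inner_add_right, inner_sub_right, inner_coe_orthogonal,
        inner_smul_right, real_inner_self_eq_norm_sq, hx.1] at this
      linarith
    refine ⟨?_, hts⟩
    simp only
    rw [norm_sqrt_smul_sq (by linarith)]
    linarith
  calc weightedVolume φ T ≤ ENNReal.ofReal (φ x + ε) * volume T :=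
        weightedVolume_le_of_forall_le hTm fun k hk => hφρ k hk.1
          ((hnear k hk).trans_le ((min_le_left _ _).trans (min_le_right _ _)))
    _ ≤ ENNReal.ofReal (φ x + ε) * volume (ellipticCap (√(1 - ε) • S) s) := by gcongr
    _ ≤ ENNReal.ofReal (c * s ^ (((m : ℝ) + 2) / 2)) := by
        rw [volume_ellipticCap hdet.ne' hs, ← ENNReal.ofReal_mul (by linarith), abs_of_pos hdet,
          det_sqrt_smul, ← mul_assoc]
        apply ENNReal.ofReal_le_ofReal
        gcongr

/-- Asymptotic lower bound, uniform in the direction, for the weighted volume of the caps cut off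
by hyperplanes through a point on the inner normal. -/
theorem le_weightedVolume_cap (hcomp : IsCompact K) (hconv : Convex ℝ K) (hφ : ContinuousOn φ K)
    (hxK : x ∈ K) (hφx : 0 < φ x) (hx : IsOuterUnitNormal K x u)
    {r t₁ : ℝ} (h : IsGraphOver K x u r t₁)
    (hA : HasLocalHessian K x u A) (hS : 0 < LinearMap.det S)
    (hSA : ∀ y, ‖S y‖ ^ 2 = inner ℝ (A (e y)) (e y)) {c : ℝ}
    (hc : c < φ x * capConst (m + 1) / LinearMap.det S) :
    ∀ᶠ s : ℝ in 𝓝[>] 0, ∀ v, ENNReal.ofReal (c * s ^ (((m : ℝ) + 2) / 2)) ≤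
      weightedVolume φ (K ∩ halfSpaceGE v (inner ℝ v (x - s • u))) := by
  have hlim : Tendsto (fun ε : ℝ => (φ x - ε) * (capConst (m + 1) /
      (√(1 + ε) ^ m * LinearMap.det S))) (𝓝[>] 0)
      (𝓝 (φ x * capConst (m + 1) / LinearMap.det S)) := by
    have : ContinuousAt (fun ε : ℝ => (φ x - ε) * (capConst (m + 1) /
      (√(1 + ε) ^ m * LinearMap.det S))) 0 := by
      apply ContinuousAt.mul (by fun_prop)
      apply ContinuousAt.div continuousAt_const (by fun_prop)
      simpa using hS.ne'
    have h2 := this.tendsto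
    simp only [add_zero, sub_zero, Real.sqrt_one, one_pow, one_mul, ← mul_div_assoc] at h2
    simp only [← mul_div_assoc]
    exact h2.mono_left nhdsWithin_le_nhds
  obtain ⟨ε, ⟨hε1, hε2⟩, hε0⟩ := ((hlim.eventually (lt_mem_nhds hc)).and
    (nhdsWithin_le_nhds (Iio_mem_nhds hφx))).and self_mem_nhdsWithin |>.exists
  have hε0 : (0 : ℝ) < ε := hε0
  have hε2 : ε < φ x := hε2
  obtain ⟨η, hη, hpinch⟩ := exists_localRep_pinched e hA hS.ne' hSA hε0
  obtain ⟨ρ, hρ, hφρ⟩ : ∃ ρ > 0, ∀ k ∈ K, ‖k - x‖ < ρ → φ x - ε ≤ φ k := by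
    obtain ⟨ρ, hρ, hh⟩ := Metric.continuousOn_iff.1 hφ x hxK ε hε0
    refine ⟨ρ, hρ, fun k hk hkρ => ?_⟩
    have := hh k hk (by rwa [dist_eq_norm])
    rw [Real.dist_eq] at this
    linarith [(abs_lt.1 this).1]
  obtain ⟨c₀, hc₀, hcS⟩ := exists_norm_le_mul hS.ne'
  set κ := min (min η ρ) r with hκ
  have hκ0 : 0 < κ := lt_min (lt_min hη hρ) h.r_pos
  have hdet : 0 < LinearMap.det (√(1 + ε) • S) := by
    have : 0 < √(1 + ε) := Real.sqrt_pos.2 (by linarith)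
    rw [det_sqrt_smul]; positivity
  -- In the comparison paraboloid truncated at height `10 s` one has `‖S y‖² ≤ 20 s`. These bounds
  -- keep it where the pinching, the density estimate and the graph description all hold.
  have hsmall : ∀ᶠ s : ℝ in 𝓝[>] 0, c₀ ^ 2 * (20 * s) + (10 * s) ^ 2 < κ ^ 2 ∧ 10 * s < t₁ := by
    have h1 : Tendsto (fun s : ℝ => c₀ ^ 2 * (20 * s) + (10 * s) ^ 2) (𝓝 0) (𝓝 0) := by
      have : Continuous fun s : ℝ => c₀ ^ 2 * (20 * s) + (10 * s) ^ 2 := by fun_prop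
      simpa using this.tendsto 0
    have h2 : Tendsto (fun s : ℝ => 10 * s) (𝓝 0) (𝓝 0) := by
      have : Continuous fun s : ℝ => 10 * s := by fun_prop
      simpa using this.tendsto 0
    exact nhdsWithin_le_nhds ((h1.eventually (gt_mem_nhds (by positivity))).and
      (h2.eventually (gt_mem_nhds h.t_pos)))
  filter_upwards [self_mem_nhdsWithin, hsmall] with s hs hss v
  have hs : (0 : ℝ) < s := hs
  set H := halfSpaceGE v (inner ℝ v (x - s • u)) with hH
  set T := K ∩ H ∩ Metric.ball x κ with hT
  have hTm : MeasurableSet T :=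
    (hcomp.isClosed.inter (isClosed_halfSpaceGE _ _)).measurableSet.inter measurableSet_ball
  -- In the chart the half-space through `x - s u` with normal `v` reads `0 ≤ ℓ y + ⟨v, u⟩ (s - t)`.
  -- The paraboloid estimate does not depend on `ℓ` or on `⟨v, u⟩`, which makes the bound uniform in
  -- `v`.
  let ℓ : EuclideanSpace ℝ (Fin m) →ₗ[ℝ] ℝ :=
    (innerₛₗ ℝ v) ∘ₗ (ℝ ∙ u)ᗮ.subtype ∘ₗ e.toLinearEquiv.toLinearMap
  have hℓ : ∀ y, ℓ y = inner ℝ v (e y : EuclideanSpace ℝ (Fin (m + 1))) := fun y => rfl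
  have hvol : ENNReal.ofReal (capConst (m + 1) / |LinearMap.det (√(1 + ε) • S)| *
      s ^ (((m : ℝ) + 2) / 2)) ≤ volume T := by
    refine (le_volume_ellipticCap_inter hdet.ne' hs ℓ (inner ℝ v u)).trans ?_
    rw [← (measurePreserving_add_hyperplaneChart e x hx.1).measure_preimage hTm.nullMeasurableSet]
    apply measure_mono
    rintro ⟨y, t⟩ ⟨⟨h1, h2⟩, h3⟩
    simp only [mem_ofPred_eq, hℓ] at h1 h2 h3
    rw [norm_sqrt_smul_sq (by linarith)] at h1
    have ht0 : 0 ≤ t := le_trans (by positivity) h1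
    have hSy : ‖S y‖ ^ 2 ≤ 20 * s := by nlinarith [sq_nonneg ‖S y‖]
    have hy2 : ‖y‖ ^ 2 ≤ c₀ ^ 2 * (20 * s) := by
      calc ‖y‖ ^ 2 ≤ (c₀ * ‖S y‖) ^ 2 := pow_le_pow_left₀ (norm_nonneg _) (hcS y) 2
        _ = c₀ ^ 2 * ‖S y‖ ^ 2 := mul_pow _ _ _
        _ ≤ _ := by gcongr
    have hnorm : ‖hyperplaneChart e (y, t)‖ < κ := by
      apply lt_of_pow_lt_pow_left₀ 2 hκ0.le
      rw [norm_hyperplaneChart_sq e hx.1]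
      have : t ^ 2 ≤ (10 * s) ^ 2 := pow_le_pow_left₀ ht0 h2 2
      simp only
      linarith [hss.1]
    have hyκ : ‖y‖ < κ := by
      apply lt_of_pow_lt_pow_left₀ 2 hκ0.le
      nlinarith [hss.1, sq_nonneg (10 * s)]
    have hp := (hpinch y (hyκ.trans_le ((min_le_left _ _).trans (min_le_left _ _)))).2
    refine ⟨⟨?_, ?_⟩, ?_⟩
    · have := h.mem_of_le hconv (y := e y)
        (by rw [e.norm_map]; exact hyκ.trans_le (min_le_right _ _)) (t := t) (by linarith)
        (by linarith [hss.2])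
      change x + hyperplaneChart e (y, t) ∈ K
      rwa [hyperplaneChart_apply, ← add_sub_assoc]
    · change inner ℝ v (x - s • u) ≤ inner ℝ v (x + hyperplaneChart e (y, t))
      rw [hyperplaneChart_apply, inner_add_right, inner_sub_right, inner_sub_right,
        inner_smul_right, inner_smul_right]
      linarith
    · rw [Metric.mem_ball, dist_eq_norm, add_sub_cancel_left]
      exact hnorm
  calc ENNReal.ofReal (c * s ^ (((m : ℝ) + 2) / 2))
      ≤ ENNReal.ofReal (φ x - ε) * ENNReal.ofReal (capConst (m + 1) /
          |LinearMap.det (√(1 + ε) • S)| * s ^ (((m : ℝ) + 2) / 2)) := by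
        rw [← ENNReal.ofReal_mul (by linarith), abs_of_pos hdet, det_sqrt_smul, ← mul_assoc]
        apply ENNReal.ofReal_le_ofReal
        gcongr
    _ ≤ ENNReal.ofReal (φ x - ε) * volume T := by gcongr
    _ ≤ weightedVolume φ T := le_weightedVolume_of_forall_le hTm fun k hk =>
        hφρ k hk.1.1 (by
          have := hk.2
          rw [Metric.mem_ball, dist_eq_norm] at this
          exact this.trans_le ((min_le_left _ _).trans (min_le_right _ _)))
    _ ≤ weightedVolume φ (K ∩ H) := weightedVolume_mono φ inter_subset_left

end CapVolume

/-! ### From cap volumes to the support function of the floating body -/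

section FloatingBody

variable {E : Type*} [NormedAddCommGroup E] [InnerProductSpace ℝ E] [MeasureSpace E]
  {K : Set E} {φ : E → ℝ} {x u : E}

/-- A half-space excluding `z` has a complementary half-space containing the parallel one through
`z`, hence cuts off more than `δ` and is not admissible. -/
theorem mem_floatingBody_of_lt {δ : ℝ} {z : E}
    (h : ∀ v, ‖v‖ = 1 →
      ENNReal.ofReal δ < weightedVolume φ (K ∩ halfSpaceGE v (inner ℝ v z))) :
    z ∈ floatingBody K φ δ := by
  rintro _ ⟨v, t, hv, ht, rfl⟩
  change inner ℝ v z ≤ t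
  by_contra! hlt
  have hsub : K ∩ halfSpaceGE v (inner ℝ v z) ⊆ K ∩ halfSpaceGE v t :=
    inter_subset_inter_right _ fun y (hy : inner ℝ v z ≤ inner ℝ v y) => hlt.le.trans hy
  exact absurd ((h v hv).trans_le (weightedVolume_mono φ hsub)) (not_lt.2 ht)

theorem inner_le_of_mem_floatingBody {δ t : ℝ} {z : E} (hz : z ∈ floatingBody K φ δ)
    (hu : ‖u‖ = 1) (h : weightedVolume φ (K ∩ halfSpaceGE u t) ≤ ENNReal.ofReal δ) :
    inner ℝ u z ≤ t :=
  hz _ ⟨u, t, hu, h, rfl⟩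

theorem tendsto_div_rpow_nhdsGT {c q : ℝ} (hc : 0 < c) (hq : 0 < q) :
    Tendsto (fun δ : ℝ => (δ / c) ^ q) (𝓝[>] 0) (𝓝[>] 0) := by
  apply tendsto_nhdsWithin_of_tendsto_nhds_of_eventually_within
  · have h1 : Tendsto (fun δ : ℝ => (δ / c) ^ q) (𝓝 0) (𝓝 ((0 / c) ^ q)) :=
      ((continuous_id.div_const c).rpow_const fun _ => Or.inr hq.le).tendsto 0
    rw [zero_div, Real.zero_rpow hq.ne'] at h1
    exact h1.mono_left nhdsWithin_le_nhds
  · filter_upwards [self_mem_nhdsWithin] with δ hδ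
    exact Real.rpow_pos_of_pos (div_pos hδ hc) _

/-- Two-sided asymptotic bounds for the caps of `K` determine the asymptotics of the support
function of the floating body. -/
theorem tendsto_supportFn_sub_div {p V : ℝ} (hp : 0 < p) (hV : 0 < V) (hu : ‖u‖ = 1)
    (hupper : ∀ c, V < c → ∀ᶠ s : ℝ in 𝓝[>] 0,
      weightedVolume φ (K ∩ halfSpaceGE u (inner ℝ u x - s)) ≤ ENNReal.ofReal (c * s ^ p))
    (hlower : ∀ c, c < V → ∀ᶠ s : ℝ in 𝓝[>] 0, ∀ v, ENNReal.ofReal (c * s ^ p) ≤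
      weightedVolume φ (K ∩ halfSpaceGE v (inner ℝ v (x - s • u)))) :
    Tendsto (fun δ : ℝ =>
      (inner ℝ u x - supportFn (floatingBody K φ δ) u) / δ ^ (1 / p)) (𝓝[>] 0)
      (𝓝 (V ^ (-(1 / p)))) := by
  have hq : 0 < 1 / p := by positivity
  have hpow : ∀ c δ : ℝ, 0 < c → 0 < δ → ((δ / c) ^ (1 / p)) ^ p = δ / c := by
    intro c δ hc hδ
    rw [← Real.rpow_mul (div_pos hδ hc).le, one_div_mul_cancel hp.ne', Real.rpow_one]
  have hratio : ∀ c δ : ℝ, 0 < c → 0 < δ → (δ / c) ^ (1 / p) = c ^ (-(1 / p)) * δ ^ (1 / p) := by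
    intro c δ hc hδ
    rw [Real.div_rpow hδ.le hc.le, Real.rpow_neg hc.le]; ring
  have hle : ∀ c, V < c → ∀ᶠ δ : ℝ in 𝓝[>] 0, ∀ z ∈ floatingBody K φ δ,
      inner ℝ u z ≤ inner ℝ u x - c ^ (-(1 / p)) * δ ^ (1 / p) := by
    intro c hc
    have hc0 := hV.trans hc
    filter_upwards [(tendsto_div_rpow_nhdsGT hc0 hq).eventually (hupper c hc),
      self_mem_nhdsWithin] with δ h hδ z hz
    have hδ : 0 < δ := hδ
    rw [hpow c δ hc0 hδ, mul_div_cancel₀ _ hc0.ne', hratio c δ hc0 hδ] at h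
    exact inner_le_of_mem_floatingBody hz hu h
  have hmem : ∀ c, 0 < c → c < V → ∀ᶠ δ : ℝ in 𝓝[>] 0,
      x - (c ^ (-(1 / p)) * δ ^ (1 / p)) • u ∈ floatingBody K φ δ := by
    intro c hc0 hc
    -- The room between `c` and `c'` turns the lower bound into `c' δ / c > δ`, the strict
    -- inequality that membership requires.
    obtain ⟨c', hcc', hc'V⟩ := exists_between hc
    filter_upwards [(tendsto_div_rpow_nhdsGT hc0 hq).eventually (hlower c' hc'V),
      self_mem_nhdsWithin] with δ h hδ
    have hδ : 0 < δ := hδ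
    rw [hpow c δ hc0 hδ, hratio c δ hc0 hδ] at h
    refine mem_floatingBody_of_lt fun v _ => lt_of_lt_of_le ?_ (h v)
    have hc'0 := hc0.trans hcc'
    rw [ENNReal.ofReal_lt_ofReal_iff (by positivity)]
    rw [← mul_div_assoc, lt_div_iff₀ hc0, mul_comm]
    gcongr
  have hcont : ContinuousAt (fun c : ℝ => c ^ (-(1 / p))) V :=
    Real.continuousAt_rpow_const _ _ (Or.inl hV.ne')
  have hinner : ∀ s : ℝ, inner ℝ u (x - s • u) = inner ℝ u x - s := fun s => by
    rw [inner_sub_right, inner_smul_right, real_inner_self_eq_norm_sq, hu]; ring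
  rw [tendsto_order]
  constructor
  · intro a ha
    obtain ⟨c, hca, hc⟩ := ((hcont.eventually (lt_mem_nhds ha)).filter_mono
      (nhdsWithin_le_nhds (s := Ioi V))).and self_mem_nhdsWithin |>.exists
    have hc : V < c := hc
    -- The constant `V / 2` only serves to show that the floating body is nonempty, so that the
    -- supremum is not a default value.
    filter_upwards [hle c hc, hmem (V / 2) (by linarith) (by linarith), self_mem_nhdsWithin]
      with δ h1 h2 hδ
    have hδ : 0 < δ := hδ
    refine hca.trans_le ?_
    rw [le_div_iff₀ (by positivity)]
    have : supportFn (floatingBody K φ δ) u ≤ inner ℝ u x - c ^ (-(1 / p)) * δ ^ (1 / p) := by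
      refine csSup_le ⟨_, _, h2, rfl⟩ ?_
      rintro _ ⟨z, hz, rfl⟩
      exact h1 z hz
    linarith
  · intro a ha
    obtain ⟨c, ⟨hca, hc0⟩, hc⟩ := (((hcont.eventually (gt_mem_nhds ha)).and
      (lt_mem_nhds hV)).filter_mono
      (nhdsWithin_le_nhds (s := Iio V))).and self_mem_nhdsWithin |>.exists
    have hc : c < V := hc
    -- The constant `2 V` only serves to bound the set of heights above, so that its real supremum
    -- is meaningful.
    filter_upwards [hle (2 * V) (by linarith), hmem c hc0 hc, self_mem_nhdsWithin]
      with δ h1 h2 hδ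
    have hδ : 0 < δ := hδ
    refine lt_of_le_of_lt ?_ hca
    rw [div_le_iff₀ (by positivity)]
    have : inner ℝ u (x - (c ^ (-(1 / p)) * δ ^ (1 / p)) • u) ≤
        supportFn (floatingBody K φ δ) u := by
      refine le_csSup ⟨inner ℝ u x - (2 * V) ^ (-(1 / p)) * δ ^ (1 / p), ?_⟩ ⟨_, h2, rfl⟩
      rintro _ ⟨z, hz, rfl⟩
      exact h1 z hz
    rw [hinner] at this
    linarith

/-- Every half-space with `x` on its boundary contains a ball of radius `r / 2` touching that
boundary at `x` and lying in `K`, so it cuts off a fixed positive weighted volume. -/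
theorem eventually_mem_floatingBody [BorelSpace E] [(volume : Measure E).IsAddHaarMeasure]
    (hcomp : IsCompact K) (hφ : ContinuousOn φ K) (hφpos : ∀ y ∈ K, 0 < φ y)
    (hx : x ∈ interior K) : ∀ᶠ δ : ℝ in 𝓝[>] 0, x ∈ floatingBody K φ δ := by
  obtain ⟨k, hk, hmin⟩ := hcomp.exists_isMinOn ⟨x, interior_subset hx⟩ hφ
  obtain ⟨r, hr, hball⟩ := Metric.isOpen_iff.1 isOpen_interior x hx
  set M : ℝ≥0∞ := ENNReal.ofReal (φ k) * volume (Metric.ball (0 : E) (r / 2)) with hM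
  have hM0 : 0 < M := ENNReal.mul_pos (ENNReal.ofReal_pos.2 (hφpos k hk)).ne'
    (Metric.measure_ball_pos volume 0 (half_pos hr)).ne'
  have hcap : ∀ v, ‖v‖ = 1 → M ≤ weightedVolume φ (K ∩ halfSpaceGE v (inner ℝ v x)) := by
    intro v hv
    have hsub : Metric.ball (x + (r / 2) • v) (r / 2) ⊆ K ∩ halfSpaceGE v (inner ℝ v x) := by
      intro y hy
      rw [Metric.mem_ball, dist_eq_norm] at hy
      have e1 : y = x + ((r / 2) • v + (y - (x + (r / 2) • v))) := by abel
      set w := y - (x + (r / 2) • v) with hw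
      have hrv : ‖(r / 2) • v‖ = r / 2 := by
        rw [norm_smul, hv, Real.norm_of_nonneg (by linarith), mul_one]
      constructor
      · apply interior_subset (hball _)
        rw [Metric.mem_ball, dist_eq_norm, e1, add_sub_cancel_left]
        refine (norm_add_le _ _).trans_lt ?_
        rw [hrv]; linarith
      · change inner ℝ v x ≤ inner ℝ v y
        have h1 : -inner ℝ v w ≤ ‖w‖ := by
          have := (neg_le_abs _).trans (abs_real_inner_le_norm v w)
          rwa [hv, one_mul] at this
        rw [e1, inner_add_right, inner_add_right, inner_smul_right, real_inner_self_eq_norm_sq, hv]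
        linarith
    refine le_trans ?_ (weightedVolume_mono φ hsub)
    rw [hM, ← Measure.addHaar_ball_center volume (x + (r / 2) • v)]
    exact le_weightedVolume_of_forall_le measurableSet_ball fun y hy => hmin (hsub hy).1
  have hlim : Tendsto (fun δ : ℝ => ENNReal.ofReal δ) (𝓝[>] 0) (𝓝 0) := by
    have := ENNReal.tendsto_ofReal (tendsto_id (x := 𝓝 (0 : ℝ)))
    rw [ENNReal.ofReal_zero] at this
    exact this.mono_left nhdsWithin_le_nhds
  filter_upwards [hlim.eventually (gt_mem_nhds hM0)] with δ hδ
  exact mem_floatingBody_of_lt fun v hv => hδ.trans_le (hcap v hv)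

end FloatingBody

/-! ### Assembly at a typical direction -/

section Main

/-- Euler's identity for degree one. At `x - x₀` it shows that the derivative of `Φ` maps this
vector to the normal `u`. -/
theorem map_eq_of_homogeneous {E : Type*} [NormedAddCommGroup E] [NormedSpace ℝ E] {Φ : E → E}
    (hΦ : ∀ c : ℝ, 0 < c → ∀ z, Φ (c • z) = c • Φ z) {z : E} {D : E →L[ℝ] E}
    (h : HasFDerivAt Φ D z) : D z = Φ z := by
  have h1 : HasDerivAt (fun c : ℝ => c • z) z 1 := by
    simpa using (hasDerivAt_id (1 : ℝ)).smul_const z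
  have h' : HasFDerivAt Φ D ((1 : ℝ) • z) := by rwa [one_smul]
  have h2 : HasDerivAt (fun c : ℝ => Φ (c • z)) (D z) 1 := h'.comp_hasDerivAt 1 h1
  have h3 : HasDerivAt (fun c : ℝ => c • Φ z) (Φ z) 1 := by
    simpa using (hasDerivAt_id (1 : ℝ)).smul_const (Φ z)
  refine h2.unique (h3.congr_of_eventuallyEq ?_)
  filter_upwards [lt_mem_nhds (one_pos : (0 : ℝ) < 1)] with c hc
  exact hΦ c hc z

theorem exists_isOuterUnitNormal {E : Type*} [NormedAddCommGroup E] [InnerProductSpace ℝ E]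
    {K : Set E} (hcomp : IsCompact K) (hne : K.Nonempty) {u : E} (hu : ‖u‖ = 1) :
    ∃ x ∈ frontier K, IsOuterUnitNormal K x u ∧ ∀ y ∈ interior K, inner ℝ u y < inner ℝ u x := by
  obtain ⟨x, hx, hmax⟩ := hcomp.exists_isMaxOn hne (f := fun k => inner ℝ u k) (by fun_prop)
  have hmax : ∀ y ∈ K, inner ℝ u y ≤ inner ℝ u x := fun y hy => hmax hy
  have hlt : ∀ y ∈ interior K, inner ℝ u y < inner ℝ u x := by
    intro y hy
    obtain ⟨r, hr, hball⟩ := Metric.isOpen_iff.1 isOpen_interior y hy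
    have hmem : y + (r / 2) • u ∈ K := by
      apply interior_subset (hball _)
      rw [Metric.mem_ball, dist_eq_norm, add_sub_cancel_left, norm_smul, hu,
        Real.norm_of_nonneg (by linarith)]
      linarith
    have := hmax _ hmem
    rw [inner_add_right, inner_smul_right, real_inner_self_eq_norm_sq, hu] at this
    linarith
  refine ⟨x, ?_, ⟨hu, hmax⟩, hlt⟩
  rw [hcomp.isClosed.frontier_eq]
  exact ⟨hx, fun hin => (hlt x hin).false⟩

/-- The tangential part of an invertible derivative of the homogeneous extension of the Gauss map
is injective. -/
theorem tangential_injective {E : Type*} [NormedAddCommGroup E] [InnerProductSpace ℝ E]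
    [FiniteDimensional ℝ E] {D : E →L[ℝ] E} (hdet : D.det ≠ 0) {z u : E} (hDz : D z = u)
    (huz : 0 < inner ℝ u z) (y : (ℝ ∙ u)ᗮ)
    (hy : (ℝ ∙ u)ᗮ.orthogonalProjectionOnto (D (y : E)) = 0) : y = 0 := by
  rw [Submodule.orthogonalProjectionOnto_eq_zero_iff, Submodule.orthogonal_orthogonal,
    Submodule.mem_span_singleton] at hy
  obtain ⟨c, hc⟩ := hy
  have hker : LinearMap.ker D.toLinearMap = ⊥ := by
    by_contra h
    exact hdet (LinearMap.det_eq_zero_iff_ker_ne_bot.2 h)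
  -- Here `D y` is a multiple `c u = D (c z)`, so `y = c z`. Since `y` is orthogonal to `u` and `z`
  -- is not, `c = 0`.
  have hyz : (y : E) = c • z := by
    apply LinearMap.ker_eq_bot.1 hker
    simp [← hc, hDz]
  have h0 := inner_coe_orthogonal y
  rw [hyz, inner_smul_right] at h0
  rcases mul_eq_zero.1 h0 with h | h
  · apply Subtype.ext
    rw [hyz, h, zero_smul]; rfl
  · exact absurd h huz.ne'

variable {m : ℕ} [NeZero m]

/-- Asymptotics of the support function of the floating body in the direction of the normal at a
boundary point with a positive definite local Hessian. -/
theorem tendsto_supportFn_floatingBody {K : Set (EuclideanSpace ℝ (Fin (m + 1)))}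
    {φ : EuclideanSpace ℝ (Fin (m + 1)) → ℝ} {x u : EuclideanSpace ℝ (Fin (m + 1))}
    (hcomp : IsCompact K) (hconv : Convex ℝ K) (hint : (interior K).Nonempty)
    (hφ : ContinuousOn φ K) (hφx : 0 < φ x) (hxK : x ∈ frontier K)
    (hu : ∀ v, IsOuterUnitNormal K x v ↔ v = u) {A : (ℝ ∙ u)ᗮ →ₗ[ℝ] (ℝ ∙ u)ᗮ}
    (hA : HasLocalHessian K x u A) (hnonneg : ∀ y, 0 ≤ inner ℝ (A y) y)
    (hinj : ∀ y, A y = 0 → y = 0) :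
    HasGradientAt (supportFn K) x u ∧
      Tendsto (fun δ : ℝ => (supportFn K u - supportFn (floatingBody K φ δ) u) /
          δ ^ (2 / (((m + 1 : ℕ) : ℝ) + 1))) (𝓝[>] 0)
        (𝓝 ((gaussKronecker K x / (capConst (m + 1) ^ 2 * φ x ^ 2)) ^
          (1 / (((m + 1 : ℕ) : ℝ) + 1)))) := by
  have hx := (hu u).2 rfl
  have hxK' : x ∈ K := hcomp.isClosed.frontier_subset hxK
  obtain ⟨r, t₁, hgraph⟩ := exists_isGraphOver hcomp hconv hint hxK' hu
  have hrank : Module.finrank ℝ (ℝ ∙ u)ᗮ = m := by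
    obtain ⟨e⟩ := exists_orthogonalEquiv hx.1
    simpa using e.toLinearEquiv.finrank_eq.symm
  obtain ⟨e, S, hSA, hS, hSdet⟩ := exists_isometryEquiv_norm_sq_eq hrank hA.1 hnonneg hinj
  have hpos : ∀ y, y ≠ 0 → 0 < inner ℝ (A y) y := by
    intro y hy
    obtain ⟨c, hc, hcS⟩ := exists_norm_le_mul hS.ne'
    have h1 := hcS (e.symm y)
    rw [e.symm.norm_map] at h1
    have h2 : 0 < ‖y‖ := norm_pos_iff.2 hy
    have h3 : 0 < ‖S (e.symm y)‖ := by
      by_contra h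
      nlinarith [norm_nonneg (S (e.symm y))]
    have h4 := hSA (e.symm y)
    rw [e.apply_symm_apply] at h4
    rw [← h4]; positivity
  have huniq : ∀ k ∈ K, inner ℝ u k = inner ℝ u x → k = x := fun k hk hku =>
    eq_of_inner_eq hgraph hconv hxK' hA hpos hk hku
  refine ⟨hasGradientAt_supportFn hcomp hxK' hx huniq, ?_⟩
  have hκ : gaussKronecker K x = LinearMap.det S ^ 2 :=
    HasGaussKronecker.gaussKronecker_eq ⟨hxK, u, hu, A, hA, hSdet.symm⟩
  have ha := capConst_pos (m + 1)
  have hV : 0 < φ x * capConst (m + 1) / LinearMap.det S := by positivity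
  have hmain := tendsto_supportFn_sub_div (K := K) (φ := φ) (x := x) (u := u)
    (p := ((m : ℝ) + 2) / 2) (by positivity) hV hx.1
    (fun c hc => weightedVolume_cap_le e hcomp hφ hxK' hφx hx huniq hgraph hA hS hSA hc)
    (fun c hc => le_weightedVolume_cap e hcomp hconv hφ hxK' hφx hx hgraph hA hS hSA hc)
  have e1 : 1 / (((m : ℝ) + 2) / 2) = 2 / (((m + 1 : ℕ) : ℝ) + 1) := by
    push_cast
    rw [one_div_div]; congr 1; ring
  -- The exponent `-2 / (d + 1)` inverts and squares `V`, and `(det S)² = det A` is the curvature.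
  have e2 : (φ x * capConst (m + 1) / LinearMap.det S) ^ (-(2 / (((m + 1 : ℕ) : ℝ) + 1))) =
      (gaussKronecker K x / (capConst (m + 1) ^ 2 * φ x ^ 2)) ^ (1 / (((m + 1 : ℕ) : ℝ) + 1)) := by
    rw [hκ, Real.rpow_neg hV.le, ← Real.inv_rpow hV.le, inv_div,
      show (2 : ℝ) / (((m + 1 : ℕ) : ℝ) + 1) = (2 : ℕ) * (1 / (((m + 1 : ℕ) : ℝ) + 1)) by
        push_cast; ring,
      Real.rpow_mul (by positivity), Real.rpow_natCast, div_pow, mul_pow,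
      mul_comm (φ x ^ 2)]
  rw [e1, e2] at hmain
  rw [hx.supportFn_eq hxK']
  exact hmain

end Main

end ConvexFloating

end

open ConvexFloating in
/-- Pointwise limit of the support functions of the weighted floating bodies of a `C^{1,1}`
convex body. -/
theorem mainTheorem8 (d : ℕ) (hd : 2 ≤ d)
    (K : ConvexBody (EuclideanSpace ℝ (Fin d)))
    (hKint : (interior (K : Set (EuclideanSpace ℝ (Fin d)))).Nonempty)
    (hK : ConvexFloating.IsClassC11 (K : Set (EuclideanSpace ℝ (Fin d))))
    (φ : EuclideanSpace ℝ (Fin d) → ℝ)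
    (hφ : ContinuousOn φ (K : Set (EuclideanSpace ℝ (Fin d))))
    (hφpos : ∀ x ∈ (K : Set (EuclideanSpace ℝ (Fin d))), 0 < φ x) :
    (∀ᶠ δ : ℝ in 𝓝[>] 0,
      (ConvexFloating.floatingBody (K : Set (EuclideanSpace ℝ (Fin d))) φ δ).Nonempty) ∧
    ∀ᵐ u ∂((Measure.hausdorffMeasure ((d : ℝ) - 1) :
        Measure (EuclideanSpace ℝ (Fin d))).restrict (Metric.sphere 0 1)),
      DifferentiableAt ℝ
        (ConvexFloating.supportFn (K : Set (EuclideanSpace ℝ (Fin d)))) u ∧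
      ConvexFloating.IsNormalBoundaryPoint (K : Set (EuclideanSpace ℝ (Fin d)))
        (gradient (ConvexFloating.supportFn (K : Set (EuclideanSpace ℝ (Fin d)))) u) ∧
      Tendsto
        (fun δ : ℝ =>
          (ConvexFloating.supportFn (K : Set (EuclideanSpace ℝ (Fin d))) u -
            ConvexFloating.supportFn
              (ConvexFloating.floatingBody (K : Set (EuclideanSpace ℝ (Fin d))) φ δ) u) /
            δ ^ (2 / ((d : ℝ) + 1)))
        (𝓝[>] 0)
        (𝓝 ((ConvexFloating.gaussKronecker (K : Set (EuclideanSpace ℝ (Fin d)))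
              (gradient (ConvexFloating.supportFn (K : Set (EuclideanSpace ℝ (Fin d)))) u) /
            (ConvexFloating.capConst d ^ 2 *
              φ (gradient
                (ConvexFloating.supportFn (K : Set (EuclideanSpace ℝ (Fin d)))) u) ^ 2)) ^
          (1 / ((d : ℝ) + 1)))) := by
  obtain ⟨m, rfl⟩ : ∃ m, d = m + 1 := ⟨d - 1, by omega⟩
  have : NeZero m := ⟨by omega⟩
  obtain ⟨-, n, hn, L, hL⟩ := hK
  obtain ⟨x₀, hx₀⟩ := hKint
  have hcomp := K.isCompact
  have hconv := K.convex
  refine ⟨(eventually_mem_floatingBody hcomp hφ hφpos hx₀).mono fun δ h => ⟨x₀, h⟩, ?_⟩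
  have hn' : ∀ p ∈ frontier (K : Set (EuclideanSpace ℝ (Fin (m + 1)))),
      IsOuterUnitNormal (K : Set (EuclideanSpace ℝ (Fin (m + 1)))) p (n p) :=
    fun p hp => (hn p hp (n p)).2 rfl
  obtain ⟨Φ, ⟨C, hC⟩, hhom, hΦ⟩ : ∃ Φ : EuclideanSpace ℝ (Fin (m + 1)) →
      EuclideanSpace ℝ (Fin (m + 1)), (∃ C : ℝ≥0, LipschitzWith C Φ) ∧
      (∀ c : ℝ, 0 < c → ∀ z, Φ (c • z) = c • Φ z) ∧
      ∀ p ∈ frontier (K : Set (EuclideanSpace ℝ (Fin (m + 1)))), Φ (p - x₀) = n p :=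
    ⟨radialExtension K x₀ n, exists_lipschitzWith_radialExtension hconv hcomp.isBounded hx₀
      (fun p hp => (hn' p hp).1) hL, fun _ hc _ => radialExtension_smul hc _,
      fun _ hp => radialExtension_sub hconv hx₀ hp⟩
  have hae := ae_sphere_hasFDerivAt_preimage hC hhom
  rw [show ((m + 1 : ℕ) : ℝ) - 1 = (m : ℝ) by push_cast; ring]
  filter_upwards [hae, ae_restrict_mem Metric.isClosed_sphere.measurableSet] with u hgood hu
  have hu : ‖u‖ = 1 := by simpa using hu
  obtain ⟨x, hxK, hx, hlt⟩ := exists_isOuterUnitNormal hcomp K.nonempty hu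
  have hnx : n x = u := ((hn x hxK u).1 hx).symm
  have hxn : ∀ v, IsOuterUnitNormal (K : Set (EuclideanSpace ℝ (Fin (m + 1)))) x v ↔ v = u :=
    fun v => by rw [← hnx]; exact hn x hxK v
  -- Outside the exceptional set every preimage of `u` under `Φ` is good, in particular `x - x₀`.
  obtain ⟨D, hD, hdet⟩ := hgood (x - x₀) (by rw [hΦ x hxK, hnx])
  have hDz : D (x - x₀) = u := by rw [map_eq_of_homogeneous hhom hD, hΦ x hxK, hnx]
  have huz : 0 < inner ℝ u (x - x₀) := by
    rw [inner_sub_right]; linarith [hlt x₀ hx₀]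
  have hxK' : x ∈ (K : Set (EuclideanSpace ℝ (Fin (m + 1)))) :=
    hcomp.isClosed.frontier_subset hxK
  obtain ⟨r, t₁, hgraph⟩ := exists_isGraphOver hcomp hconv ⟨x₀, hx₀⟩ hxK' hxn
  have hND : HasFDerivAt (fun p => Φ (p - x₀)) D x := (hasFDerivAt_comp_sub x₀).2 hD
  have hA := hgraph.hasLocalHessian hcomp hxK' hu
    (N := fun p => Φ (p - x₀))
    (hC.continuous.comp (continuous_id.sub continuous_const))
    (fun p hp => by simpa only [hΦ p hp] using hn' p hp) (by simp only [hΦ x hxK, hnx])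
    hND
  obtain ⟨hgrad, hlim⟩ := tendsto_supportFn_floatingBody hcomp hconv ⟨x₀, hx₀⟩ hφ
    (hφpos x hxK') hxK hxn hA
    (quadratic_nonneg_of_isLittleO hA.2 (by
      filter_upwards [Metric.ball_mem_nhds 0 hgraph.r_pos] with y hy
      exact hgraph.nonneg y (by simpa using hy)))
    (fun y hy => tangential_injective hdet hDz huz y hy)
  rw [hgrad.gradient]
  exact ⟨hgrad.differentiableAt, ⟨hxK, u, hxn, _, hA⟩, hlim⟩
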